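/- **Setting.** For $f:\mathbb R\to\mathbb C$ put $f^*(k)=\frac1{\sqrt{2\pi}}\int_{\mathbb R}e^{ikx}f(x)\,dx$; for a function of $(x,t)$ the star refers to the variable $x$. For $\nu\in\mathbb R$, ${}_0D_t^{\nu}$ is the Riemann–Liouville derivative: if $m\ge 0$ is the least integer with $m\ge\nu$, then ${}_0D_t^\nu f=\frac{d^m}{dt^m}\,{}_0I_t^{m-\nu}f$, where ${}_0I_t^{\sigma}f(t)=\frac1{\Gamma(\sigma)}\int_0^t (t-u)^{\sigma-1}f(u)\,du$ for $\sigma>0$ and ${}_0I_t^0f=f$ (so for $\nu\le 0$ it is ${}_0I_t^{-\nu}$). With $\Psi_\theta^\gamma(k)=|k|^\gamma e^{i\,\mathrm{sign}(k)\theta\pi/2}$, the Riesz–Feller derivative is ${}_xD_\theta^\gamma f(x)=\frac1{\sqrt{2\pi}}\int_{\mathbb R}e^{-ikx}\bigl(-\Psi_\theta^\gamma(k)\bigr)f^*(k)\,dk$. Finally $E_{\alpha,\beta}^{\delta}(z)=\sum_{m\ge0}\frac{(\delta)_m z^m}{\Gamma(\alpha m+\beta)\,m!}$, with $(\delta)_m$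 the Pochhammer symbol. **Theorem.** Let $1<\beta\le\alpha\le2$ and $\lambda\in\mathbb R$, with $|\lambda|<1$ if $\beta=\alpha$. For $j=1,\dots,n$ let $\mu_j>0$, $0<\gamma_j\le2$, $|\theta_j|\le\min(\gamma_j,2-\gamma_j)$, and put $b(k)=\sum_{j=1}^n\mu_j\Psi_{\theta_j}^{\gamma_j}(k)$. Let $f_1,g_1,f_2,g_2\in L^1(\mathbb R)$ and let $\phi$ be integrable on $\mathbb R\times(0,T)$ for every $T>0$ (all complex-valued). Let $N$ solve $${}_0D_t^{\alpha}N(x,t)+\lambda\,{}_0D_t^{\beta}N(x,t)=\sum_{j=1}^n\mu_j\,{}_xD_{\theta_j}^{\gamma_j}N(x,t)+\phi(x,t),\qquad x\in\mathbb R,\ t>0,$$ with $\lim_{x\to\pm\infty}N(x,t)=0$ for $t>0$ and with the initial conditions, as $t\to0^+$ and for every $x$, $$\bigl({}_0D_t^{\alpha-1}+\lambda\,{}_0D_t^{\beta-1}\bigr)N(x,t)\to f_1(x)+\lambda f_2(x),\qquad \bigl({}_0D_t^{\alpha-2}+\lambda\,{}_0D_t^{\beta-2}\bigr)N(x,t)\to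 g_1(x)+\lambda g_2(x);$$ these hold in particular if ${}_0D_t^{\alpha-1}N(x,0)=f_1(x)$, ${}_0D_t^{\alpha-2}N(x,0)=g_1(x)$, ${}_0D_t^{\beta-1}N(x,0)=f_2(x)$ and ${}_0D_t^{\beta-2}N(x,0)=g_2(x)$ separately. The solution is understood in the following sense: $N$ is continuous on $\mathbb R\times(0,\infty)$; for all $T>0$ it is integrable on $\mathbb R\times(0,T)$, and $N(x,\cdot)$ is integrable on $(0,T)$ for every $x$; $t\mapsto N(\cdot,t)$ is a continuous map from $(0,\infty)$ into $L^1(\mathbb R)$; for each $j$ the function $\Psi_{\theta_j}^{\gamma_j}(k)N^*(k,t)$ is integrable over $k\in\mathbb R$ for every $t>0$ and over $\mathbb R\times(0,T)$ for every $T>0$; and for every $x$ the functions ${}_0D_t^{\alpha-2}N$, ${}_0D_t^{\alpha-1}N$, ${}_0D_t^{\beta-2}N$, ${}_0D_t^{\beta-1}N$ are differentiable in $t>0$. (a) For every $t>0$ for which the outer ($k$-)integrals and the series on the right below converge absolutely (each $k$-integrand is integrable, and in each of the three series the sum over $r$ of the $L^1(dk)$-norms of the terms is finite), and for every $x\in\mathbb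 R$, $$\begin{aligned}N(x,t)=&\sum_{r=0}^\infty\frac{(-\lambda)^r t^{(\alpha-\beta)r+\alpha-1}}{\sqrt{2\pi}}\int_{-\infty}^\infty e^{-ikx}\,[f_1^*(k)+\lambda f_2^*(k)]\,E^{r+1}_{\alpha,\alpha+(\alpha-\beta)r}(-b(k)t^\alpha)\,dk\\&+\sum_{r=0}^\infty\frac{(-\lambda)^r t^{(\alpha-\beta)r+\alpha-2}}{\sqrt{2\pi}}\int_{-\infty}^\infty e^{-ikx}\,[g_1^*(k)+\lambda g_2^*(k)]\,E^{r+1}_{\alpha,\alpha+(\alpha-\beta)r-1}(-b(k)t^\alpha)\,dk\\&+\sum_{r=0}^\infty\frac{(-\lambda)^r}{\sqrt{2\pi}}\int_{-\infty}^\infty e^{-ikx}\int_0^t\phi^*(k,t-\xi)\,\xi^{(\alpha-\beta)r+\alpha-1}E^{r+1}_{\alpha,\alpha+(\alpha-\beta)r}(-b(k)\xi^\alpha)\,d\xi\,dk .\end{aligned}$$ (b) If, with $w_c(k)=\exp\bigl(c\,(\sum_j\mu_j|k|^{\gamma_j})^{1/\alpha}\bigr)$, the functions $w_cf_1^*,w_cg_1^*,w_cf_2^*,w_cg_2^*$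 are integrable on $\mathbb R$ and $w_c(k)\phi^*(k,\tau)$ is integrable on $\mathbb R\times(0,T)$ for all $c,T>0$, then this absolute convergence holds for every $t>0$. -/

import Mathlib

open MeasureTheory Filter Topology

noncomputable section

namespace FracRD

/-- The Riemann-Liouville fractional integral `₀I_t^ν f (t)` of order `ν ≥ 0`
(with `₀I_t^0 f = f`). -/
def rlIntegral (ν : ℝ) (f : ℝ → ℂ) (t : ℝ) : ℂ :=
  if ν = 0 then f t
  else ((1 / Real.Gamma ν : ℝ) : ℂ) * ∫ u in (0 : ℝ)..t, (((t - u) ^ (ν - 1) : ℝ) : ℂ) * f u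

/-- The Riemann-Liouville fractional derivative `₀D_t^ν f (t) = (d/dt)^m ₀I_t^{m-ν} f (t)`,
`m - 1 < ν ≤ m`. For `ν ≤ 0` we have `m = 0`, and this is the fractional integral of
order `-ν`. -/
def rlDeriv (ν : ℝ) (f : ℝ → ℂ) (t : ℝ) : ℂ :=
  iteratedDeriv ⌈ν⌉₊ (rlIntegral ((⌈ν⌉₊ : ℝ) - ν) f) t

/-- The Fourier transform `f*(k) = (2π)^{-1/2} ∫ e^{ikx} f(x) dx`. -/
def fourierT (f : ℝ → ℂ) (k : ℝ) : ℂ :=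
  ((1 / Real.sqrt (2 * Real.pi) : ℝ) : ℂ) *
    ∫ x : ℝ, Complex.exp (Complex.I * (k : ℂ) * (x : ℂ)) * f x

/-- The inverse Fourier transform `(2π)^{-1/2} ∫ e^{-ikx} h(k) dk`. -/
def fourierInvT (h : ℝ → ℂ) (x : ℝ) : ℂ :=
  ((1 / Real.sqrt (2 * Real.pi) : ℝ) : ℂ) *
    ∫ k : ℝ, Complex.exp (-Complex.I * (k : ℂ) * (x : ℂ)) * h k

/-- `Ψ_θ^γ(k) = |k|^γ e^{i sign(k) θ π / 2}`. -/
def rfSymbol (γ θ k : ℝ) : ℂ :=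
  ((|k| ^ γ : ℝ) : ℂ) * Complex.exp (Complex.I * ((Real.sign k * θ * Real.pi / 2 : ℝ) : ℂ))

/-- The Riesz-Feller space-fractional derivative of order `γ` and skewness `θ`: the
pseudo-differential operator with symbol `-Ψ_θ^γ`. -/
def rieszFeller (γ θ : ℝ) (f : ℝ → ℂ) : ℝ → ℂ :=
  fourierInvT fun k => -(rfSymbol γ θ k) * fourierT f k

/-- `b(k) = ∑_j μ_j Ψ_{θ_j}^{γ_j}(k)`. -/
def bSymbol {n : ℕ} (μ γ θ : Fin n → ℝ) (k : ℝ) : ℂ :=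
  ∑ j, (μ j : ℂ) * rfSymbol (γ j) (θ j) k

/-- The three-parameter (Prabhakar) Mittag-Leffler function
`E_{α,β}^δ(z) = ∑_m (δ)_m z^m / (Γ(α m + β) m!)`. -/
def mittagLeffler (α β δ : ℝ) (z : ℂ) : ℂ :=
  ∑' m : ℕ, (((ascPochhammer ℝ m).eval δ / (Real.Gamma (α * m + β) * m.factorial) : ℝ) : ℂ) * z ^ m

/-- `N` is a solution, in the class of functions to which the Fourier transform in `x` applies,
of `₀D_t^α N + λ ₀D_t^β N = ∑_j μ_j ₓD_{θ_j}^{γ_j} N + φ` on `ℝ × (0, ∞)`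
with `N(x, t) → 0` as `x → ±∞`. -/
structure IsSolution {n : ℕ} (α β lam : ℝ) (μ γ θ : Fin n → ℝ) (φ N : ℝ → ℝ → ℂ) : Prop where
  /-- `N` is continuous for `t > 0`. -/
  continuousOn : ContinuousOn (fun p : ℝ × ℝ => N p.1 p.2) (Set.univ ×ˢ Set.Ioi 0)
  /-- `N(x, ·)` is integrable up to `t = 0`. -/
  integrable_time : ∀ x T : ℝ, 0 < T → IntegrableOn (N x) (Set.Ioc 0 T)
  /-- `N` is integrable on strips. -/
  integrable_strip : ∀ T : ℝ, 0 < T →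
    IntegrableOn (fun p : ℝ × ℝ => N p.1 p.2) (Set.univ ×ˢ Set.Ioc 0 T)
  /-- `t ↦ N(·, t)` takes values in `L¹(ℝ)` for `t > 0` ... -/
  integrable_space : ∀ t : ℝ, 0 < t → Integrable (fun x => N x t)
  /-- ... and is continuous in `L¹(ℝ)`. -/
  continuous_L1 : ∀ t : ℝ, 0 < t →
    Tendsto (fun s => ∫ x, ‖N x s - N x t‖) (𝓝 t) (𝓝 0)
  /-- The Riesz-Feller derivatives of `N(·, t)` are given by absolutely convergent integrals. -/
  integrable_symbol : ∀ (j : Fin n) (t : ℝ), 0 < t →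
    Integrable (fun k => rfSymbol (γ j) (θ j) k * fourierT (fun x => N x t) k)
  /-- They are controlled near `t = 0`. -/
  integrable_symbol_strip : ∀ (j : Fin n) (T : ℝ), 0 < T →
    IntegrableOn (fun p : ℝ × ℝ => rfSymbol (γ j) (θ j) p.1 * fourierT (fun x => N x p.2) p.1)
      (Set.univ ×ˢ Set.Ioc 0 T)
  /-- The fractional time derivatives exist for `t > 0`. -/
  differentiable_alpha : ∀ x t : ℝ, 0 < t →
    DifferentiableAt ℝ (rlDeriv (α - 2) (N x)) t ∧ DifferentiableAt ℝ (rlDeriv (α - 1) (N x)) t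
  differentiable_beta : ∀ x t : ℝ, 0 < t →
    DifferentiableAt ℝ (rlDeriv (β - 2) (N x)) t ∧ DifferentiableAt ℝ (rlDeriv (β - 1) (N x)) t
  /-- The equation. -/
  equation : ∀ x t : ℝ, 0 < t →
    rlDeriv α (N x) t + (lam : ℂ) * rlDeriv β (N x) t =
      ∑ j, (μ j : ℂ) * rieszFeller (γ j) (θ j) (fun y => N y t) x + φ x t
  /-- The boundary conditions. -/
  tendsto_atTop : ∀ t : ℝ, 0 < t → Tendsto (fun x => N x t) atTop (𝓝 0)
  tendsto_atBot : ∀ t : ℝ, 0 < t → Tendsto (fun x => N x t) atBot (𝓝 0)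

/-- The four separate initial conditions `₀D_t^{α-1} N(x,0) = f₁(x)`, `₀D_t^{α-2} N(x,0) = g₁(x)`,
`₀D_t^{β-1} N(x,0) = f₂(x)`, `₀D_t^{β-2} N(x,0) = g₂(x)`. -/
structure SeparateInitialData (α β : ℝ) (f₁ g₁ f₂ g₂ : ℝ → ℂ) (N : ℝ → ℝ → ℂ) : Prop where
  f₁ : ∀ x, Tendsto (rlDeriv (α - 1) (N x)) (𝓝[>] 0) (𝓝 (f₁ x))
  g₁ : ∀ x, Tendsto (rlDeriv (α - 2) (N x)) (𝓝[>] 0) (𝓝 (g₁ x))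
  f₂ : ∀ x, Tendsto (rlDeriv (β - 1) (N x)) (𝓝[>] 0) (𝓝 (f₂ x))
  g₂ : ∀ x, Tendsto (rlDeriv (β - 2) (N x)) (𝓝[>] 0) (𝓝 (g₂ x))

/-- The initial conditions in the (weaker) combined form in which they enter the equation:
`(₀D_t^{α-1} + λ ₀D_t^{β-1}) N(x,0) = f₁(x) + λ f₂(x)` and
`(₀D_t^{α-2} + λ ₀D_t^{β-2}) N(x,0) = g₁(x) + λ g₂(x)`. The four separate conditions imply them
(see below), but when `β < α` those also force `g₁ = f₂ = g₂ = 0`, while these do not. -/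
structure HasInitialData (α β lam : ℝ) (f₁ g₁ f₂ g₂ : ℝ → ℂ) (N : ℝ → ℝ → ℂ) : Prop where
  first : ∀ x, Tendsto (fun t => rlDeriv (α - 1) (N x) t + (lam : ℂ) * rlDeriv (β - 1) (N x) t)
    (𝓝[>] 0) (𝓝 (f₁ x + (lam : ℂ) * f₂ x))
  second : ∀ x, Tendsto (fun t => rlDeriv (α - 2) (N x) t + (lam : ℂ) * rlDeriv (β - 2) (N x) t)
    (𝓝[>] 0) (𝓝 (g₁ x + (lam : ℂ) * g₂ x))

theorem SeparateInitialData.hasInitialData {α β : ℝ} {f₁ g₁ f₂ g₂ : ℝ → ℂ} {N : ℝ → ℝ → ℂ}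
    (h : SeparateInitialData α β f₁ g₁ f₂ g₂ N) (lam : ℝ) :
    HasInitialData α β lam f₁ g₁ f₂ g₂ N :=
  ⟨fun x => (h.f₁ x).add ((h.f₂ x).const_mul _), fun x => (h.g₁ x).add ((h.g₂ x).const_mul _)⟩

/-- The integrals `∫ c_r(k) dk` and the series of these integrals converge absolutely. -/
def AbsConv (c : ℕ → ℝ → ℂ) : Prop :=
  (∀ r, Integrable (c r)) ∧ Summable fun r => ∫ k, ‖c r k‖

/-- The integrals and the series on the right-hand side of the solution formula converge
absolutely at time `t`. (The factor `e^{-ikx}` has modulus one, so `x` does not matter.) -/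
structure FormulaConverges {n : ℕ} (α β lam : ℝ) (μ γ θ : Fin n → ℝ) (f₁ g₁ f₂ g₂ : ℝ → ℂ)
    (φ : ℝ → ℝ → ℂ) (t : ℝ) : Prop where
  first : AbsConv fun r k => (-(lam : ℂ)) ^ r * ((t ^ ((α - β) * r + α - 1) : ℝ) : ℂ) *
    ((fourierT f₁ k + (lam : ℂ) * fourierT f₂ k) *
      mittagLeffler α (α + (α - β) * r) (r + 1) (-(bSymbol μ γ θ k) * ((t ^ α : ℝ) : ℂ)))
  second : AbsConv fun r k => (-(lam : ℂ)) ^ r * ((t ^ ((α - β) * r + α - 2) : ℝ) : ℂ) *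
    ((fourierT g₁ k + (lam : ℂ) * fourierT g₂ k) *
      mittagLeffler α (α + (α - β) * r - 1) (r + 1) (-(bSymbol μ γ θ k) * ((t ^ α : ℝ) : ℂ)))
  third : AbsConv fun r k => (-(lam : ℂ)) ^ r *
    ∫ ξ in (0 : ℝ)..t, fourierT (fun y => φ y (t - ξ)) k *
      ((ξ ^ ((α - β) * r + α - 1) : ℝ) : ℂ) *
      mittagLeffler α (α + (α - β) * r) (r + 1) (-(bSymbol μ γ θ k) * ((ξ ^ α : ℝ) : ℂ))

/-- The weight `exp(c (∑_j μ_j |k|^{γ_j})^{1/α})`. -/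
def weight {n : ℕ} (α : ℝ) (μ γ : Fin n → ℝ) (c k : ℝ) : ℝ :=
  Real.exp (c * (∑ j, μ j * |k| ^ γ j) ^ (1 / α))

/-- A decay condition on the Fourier transforms of the data. -/
structure RapidDecay {n : ℕ} (α : ℝ) (μ γ : Fin n → ℝ) (f₁ g₁ f₂ g₂ : ℝ → ℂ)
    (φ : ℝ → ℝ → ℂ) : Prop where
  f₁ : ∀ c : ℝ, 0 < c → Integrable (fun k => weight α μ γ c k * ‖fourierT f₁ k‖)
  g₁ : ∀ c : ℝ, 0 < c → Integrable (fun k => weight α μ γ c k * ‖fourierT g₁ k‖)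
  f₂ : ∀ c : ℝ, 0 < c → Integrable (fun k => weight α μ γ c k * ‖fourierT f₂ k‖)
  g₂ : ∀ c : ℝ, 0 < c → Integrable (fun k => weight α μ γ c k * ‖fourierT g₂ k‖)
  φ : ∀ c T : ℝ, 0 < c → 0 < T →
    IntegrableOn (fun p : ℝ × ℝ => weight α μ γ c p.1 * ‖fourierT (fun y => φ y p.2) p.1‖)
      (Set.univ ×ˢ Set.Ioc 0 T)

end FracRD

end

/-!
# The solution formula for a two-term fractional reaction-diffusion equation

Put `δ = α - β`. In Fourier space the equation decouples: for fixed `k` the mode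
`n(t) = N*(k, t)` satisfies, with `b = b(k)` and with the transforms `f`, `g` of `f₁ + λ f₂` and
`g₁ + λ g₂`,

  `₀I^{2-α} n + λ ₀I^{2-β} n = g + t f + ₀I² (φ* - b n)`,

which is the equation integrated twice in time (`IsMode`, `IsSolution.isMode`). To obtain it, the
left-hand side is first expanded by Taylor's formula for almost every fixed `x`
(`IsSolution.integrated`). Its Fourier transform is then computed with Fubini's theorem, except
for the Riesz-Feller part: that one is the inverse transform of the continuous integrable function
`-b(k) ₀I² N*(k, ·)`, and being a difference of integrable functions of `x` it is integrable, so
that Fourier inversion applies (`fourierT_fourierInvT`). The fractional integrals of `N` are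
integrable in `x` at every time since `‖N(·, t)‖₁` is continuous for `t > 0`.

No growth of `n` at infinity is known, so the mode equation is solved without the Laplace
transform. The double series `mlKernel`, of order `σ`,

  `∑_{r,m} (-λ)^r C(r+m, m) (-b)^m t^{α m + δ r + σ - 1} / Γ(α m + δ r + σ)`,

is the expansion of `s^{-σ} / (1 + λ s^{-δ} + b s^{-α})`. Applying `₀I^{α m + δ r + α - 1}` to the
mode equation turns all its terms into integrals of order at least one, where the semigroup property
`₀I^p ₀I^q = ₀I^{p+q}` holds pointwise (`rlIntegral_rlIntegral`). Summing against the coefficients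
of the series, everything on the left cancels by Pascal's rule (`pascal_sum`) except `∫₀^t n`, and
comparing continuous integrands expresses `n` through `mlKernel` (`IsMode.eq_mlKernel`). Summation
over `m` alone produces the Prabhakar functions (`hasSum_mittagLeffler`), and absolute convergence
permits the term by term Fourier inversion of `n`.

All convergence statements rest on `1 / Γ(x) ≤ s^{1-x} e^s` for `x > 0` and `s ≥ 1`
(`inv_Gamma_le`): it dominates the double series by the binomial series of
`1 / (1 - |λ| (T/s)^δ - |b| (T/s)^α)`, and with `s` proportional to `1 + |b|^{1/α}` the bound is a
constant times `exp(c |b|^{1/α})`, which is the weight in the decay condition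
(`exists_mlTerm_bound`).
-/

noncomputable section

namespace FracRD

open scoped FourierTransform

/-! ### Fourier transforms -/

theorem fourierT_neg (f : ℝ → ℂ) (k : ℝ) : fourierT f (-k) = fourierInvT f k := by
  rw [fourierT, fourierInvT]
  congr 2
  ext x
  rw [show Complex.I * ((-k : ℝ) : ℂ) * (x : ℂ) = -Complex.I * (x : ℂ) * (k : ℂ) by
    push_cast; ring]

theorem fourierInvT_neg (f : ℝ → ℂ) (k : ℝ) : fourierInvT f (-k) = fourierT f k := by
  rw [← fourierT_neg, neg_neg]

theorem fourierT_eq_fourier (f : ℝ → ℂ) (k : ℝ) :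
    fourierT f k = ((1 / Real.sqrt (2 * Real.pi) : ℝ) : ℂ) * 𝓕 f (-(k / (2 * Real.pi))) := by
  rw [fourierT, Real.fourier_real_eq_integral_exp_smul]
  congr 2
  ext x
  rw [smul_eq_mul]
  congr 2
  have : (Real.pi : ℂ) ≠ 0 := by exact_mod_cast Real.pi_ne_zero
  push_cast
  field_simp

theorem norm_cexp_I_mul (k x : ℝ) : ‖Complex.exp (Complex.I * (k : ℂ) * (x : ℂ))‖ = 1 := by
  rw [mul_assoc, mul_comm, ← Complex.ofReal_mul]
  exact Complex.norm_exp_ofReal_mul_I _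

theorem norm_cexp_neg_I_mul (k x : ℝ) : ‖Complex.exp (-Complex.I * (k : ℂ) * (x : ℂ))‖ = 1 := by
  rw [show -Complex.I * (k : ℂ) * (x : ℂ) = Complex.I * (k : ℂ) * ((-x : ℝ) : ℂ) by
    push_cast; ring]
  exact norm_cexp_I_mul k (-x)

theorem integrable_cexp_mul {X : Type*} [MeasurableSpace X] {ν : Measure X} {h : X → ℂ}
    (hh : Integrable h ν) {e : X → ℂ} (he : AEStronglyMeasurable e ν) (he1 : ∀ x, ‖e x‖ = 1) :
    Integrable (fun x => e x * h x) ν :=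
  hh.bdd_mul he (ae_of_all _ fun x => (he1 x).le)

theorem continuous_fourierT {f : ℝ → ℂ} (hf : Integrable f) : Continuous (fourierT f) := by
  unfold fourierT
  refine continuous_const.mul ?_
  refine continuous_of_dominated (bound := fun x => ‖f x‖) ?_ ?_ hf.norm ?_
  · intro k
    exact (by fun_prop : Continuous fun x : ℝ =>
      Complex.exp (Complex.I * (k : ℂ) * (x : ℂ))).aestronglyMeasurable.mul hf.1
  · intro k
    refine ae_of_all _ fun x => ?_
    rw [norm_mul, norm_cexp_I_mul, one_mul]
  · exact ae_of_all _ fun x => by fun_prop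

theorem norm_fourierT_le (f : ℝ → ℂ) (k : ℝ) :
    ‖fourierT f k‖ ≤ 1 / Real.sqrt (2 * Real.pi) * ∫ x, ‖f x‖ := by
  rw [fourierT, norm_mul, Complex.norm_real, Real.norm_of_nonneg (by positivity)]
  gcongr
  refine (norm_integral_le_integral_norm _).trans (le_of_eq ?_)
  congr 1
  ext x
  rw [norm_mul, norm_cexp_I_mul, one_mul]

theorem fourierT_add {f g : ℝ → ℂ} (hf : Integrable f) (hg : Integrable g) (k : ℝ) :
    fourierT (fun x => f x + g x) k = fourierT f k + fourierT g k := by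
  simp only [fourierT]
  rw [← mul_add, ← integral_add]
  · simp only [mul_add]
  · exact integrable_cexp_mul hf (by fun_prop) (norm_cexp_I_mul k)
  · exact integrable_cexp_mul hg (by fun_prop) (norm_cexp_I_mul k)

theorem fourierT_const_mul (c : ℂ) (f : ℝ → ℂ) (k : ℝ) :
    fourierT (fun x => c * f x) k = c * fourierT f k := by
  simp only [fourierT]
  simp only [mul_left_comm _ c, integral_const_mul]

theorem fourierT_sub {f g : ℝ → ℂ} (hf : Integrable f) (hg : Integrable g) (k : ℝ) :
    fourierT (fun x => f x - g x) k = fourierT f k - fourierT g k := by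
  have := fourierT_add hf (hg.const_mul (-1)) k
  rw [fourierT_const_mul] at this
  simpa [sub_eq_add_neg] using this

theorem fourierT_congr_ae {f g : ℝ → ℂ} (h : f =ᵐ[volume] g) (k : ℝ) :
    fourierT f k = fourierT g k := by
  simp only [fourierT]
  congr 1
  exact integral_congr_ae (h.mono fun x hx => by simp only [hx])

/-- Fourier inversion for a continuous integrable function with integrable Fourier transform. -/
theorem fourierInvT_fourierT {f : ℝ → ℂ} (hf : Integrable f) (hc : Continuous f)
    (hF : Integrable (fourierT f)) (x : ℝ) : fourierInvT (fourierT f) x = f x := by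
  have h2 : (0 : ℝ) < 2 * Real.pi := by positivity
  have hs : (Real.sqrt (2 * Real.pi) : ℂ) ≠ 0 := by
    exact_mod_cast (Real.sqrt_pos.2 h2).ne'
  have hs2 : (Real.sqrt (2 * Real.pi) : ℂ) * (Real.sqrt (2 * Real.pi) : ℂ) = 2 * Real.pi := by
    rw [← Complex.ofReal_mul, Real.mul_self_sqrt h2.le]; push_cast; ring
  have hF' : Integrable (𝓕 f) := by
    have h3 := hF.comp_mul_left' (R := -(2 * Real.pi)) (by linarith)
    have h4 := h3.const_mul (Real.sqrt (2 * Real.pi) : ℂ)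
    refine h4.congr (ae_of_all _ fun v => ?_)
    simp only [fourierT_eq_fourier]
    rw [show -(-(2 * Real.pi) * v / (2 * Real.pi)) = v by field_simp]
    push_cast
    field_simp
  have key := congrFun (Continuous.fourierInv_fourier_eq hc hf hF') x
  rw [← key, Real.fourierInv_eq', fourierInvT]
  have h5 := Measure.integral_comp_mul_left (fun k : ℝ =>
    Complex.exp (-Complex.I * (k : ℂ) * (x : ℂ)) * fourierT f k) (-(2 * Real.pi))
  have h6 : |(-(2 * Real.pi))⁻¹| = (2 * Real.pi)⁻¹ := by
    rw [abs_inv, abs_neg, abs_of_pos h2]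
  rw [h6] at h5
  have h7 : (∫ k : ℝ, Complex.exp (-Complex.I * (k : ℂ) * (x : ℂ)) * fourierT f k) =
      ((2 * Real.pi : ℝ) : ℂ) * ∫ v : ℝ,
        Complex.exp (-Complex.I * ((-(2 * Real.pi) * v : ℝ) : ℂ) * (x : ℂ)) *
          fourierT f (-(2 * Real.pi) * v) := by
    rw [h5, Complex.real_smul, ← mul_assoc, ← Complex.ofReal_mul, mul_inv_cancel₀ h2.ne']
    simp
  rw [h7, ← integral_const_mul, ← integral_const_mul]
  congr 1
  ext v
  simp only [fourierT_eq_fourier]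
  rw [show -(-(2 * Real.pi) * v / (2 * Real.pi)) = v by field_simp]
  simp only [RCLike.inner_apply, conj_trivial, smul_eq_mul]
  rw [show -Complex.I * ((-(2 * Real.pi) * v : ℝ) : ℂ) * (x : ℂ) =
    ((2 * Real.pi * (x * v) : ℝ) : ℂ) * Complex.I by push_cast; ring]
  push_cast
  rw [← hs2]
  field_simp

/-- Fourier inversion in the other order. -/
theorem fourierT_fourierInvT {h : ℝ → ℂ} (hh : Integrable h) (hc : Continuous h)
    (hF : Integrable (fourierInvT h)) (k : ℝ) : fourierT (fourierInvT h) k = h k := by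
  have h1 : Integrable (fourierT h) := by
    refine hF.comp_neg.congr (ae_of_all _ fun x => ?_)
    exact fourierInvT_neg h x
  rw [← fourierInvT_fourierT hh hc h1 k]
  rw [fourierT, fourierInvT, ← integral_neg_eq_self]
  congr 2
  funext y
  rw [fourierInvT_neg]
  congr 2
  push_cast
  ring

theorem integrable_timeIntegral {w : ℝ → ℂ} {Φ : ℝ → ℝ → ℂ} {T : ℝ} (hT : 0 ≤ T)
    (h : IntegrableOn (fun p : ℝ × ℝ => w p.2 * Φ p.1 p.2) (Set.univ ×ˢ Set.Ioc 0 T)) :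
    Integrable (fun x => ∫ s in (0 : ℝ)..T, w s * Φ x s) := by
  rw [IntegrableOn, Measure.volume_eq_prod, ← Measure.prod_restrict, Measure.restrict_univ] at h
  simpa only [intervalIntegral.integral_of_le hT] using h.integral_prod_left

/-- Fubini's theorem for the Fourier transform in `x` of a weighted time integral. -/
theorem fourierT_timeIntegral {w : ℝ → ℂ} {Φ : ℝ → ℝ → ℂ} {T : ℝ} (hT : 0 ≤ T)
    (h : IntegrableOn (fun p : ℝ × ℝ => w p.2 * Φ p.1 p.2) (Set.univ ×ˢ Set.Ioc 0 T)) (k : ℝ) :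
    fourierT (fun x => ∫ s in (0 : ℝ)..T, w s * Φ x s) k =
      ∫ s in (0 : ℝ)..T, w s * fourierT (fun x => Φ x s) k := by
  rw [IntegrableOn, Measure.volume_eq_prod, ← Measure.prod_restrict, Measure.restrict_univ] at h
  have h1 : Integrable (Function.uncurry fun (x s : ℝ) =>
      Complex.exp (Complex.I * (k : ℂ) * (x : ℂ)) * (w s * Φ x s))
      (volume.prod (volume.restrict (Set.Ioc 0 T))) :=
    integrable_cexp_mul (e := fun p : ℝ × ℝ => Complex.exp (Complex.I * (k : ℂ) * (p.1 : ℂ)))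
      h (by fun_prop) (fun p => norm_cexp_I_mul k p.1)
  simp only [intervalIntegral.integral_of_le hT, fourierT]
  have h2 := integral_integral_swap h1
  simp only [integral_const_mul] at h2
  simp only [h2, mul_left_comm _ (w _), integral_const_mul]
  rw [← integral_const_mul]
  simp only [mul_left_comm _ (w _)]

theorem fourierInvT_timeIntegral {w : ℝ → ℂ} {Φ : ℝ → ℝ → ℂ} {T : ℝ} (hT : 0 ≤ T)
    (h : IntegrableOn (fun p : ℝ × ℝ => w p.2 * Φ p.1 p.2) (Set.univ ×ˢ Set.Ioc 0 T)) (x : ℝ) :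
    fourierInvT (fun k => ∫ s in (0 : ℝ)..T, w s * Φ k s) x =
      ∫ s in (0 : ℝ)..T, w s * fourierInvT (fun k => Φ k s) x := by
  simp only [← fourierT_neg]
  exact fourierT_timeIntegral hT h (-x)

/-! ### The double series and Prabhakar functions -/

/-- `(r, m) ↦ (-λ)^r C(r+m, m) (-b)^m`, the coefficients of `1 / (1 + λ u + b v)` as a power
series in `u` and `v`. -/
def mlCoeff (lam : ℝ) (b : ℂ) (p : ℕ × ℕ) : ℂ :=
  (-(lam : ℂ)) ^ p.1 * ((p.1 + p.2).choose p.2 : ℂ) * (-b) ^ p.2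

/-- The exponent `α m + δ r` that goes with the coefficient of index `(r, m)`. -/
def mlExp (α δ : ℝ) (p : ℕ × ℕ) : ℝ := α * p.2 + δ * p.1

/-- The kernel `t^{σ-1} / Γ(σ)` of the Riemann-Liouville integral of order `σ`. -/
def rlKernel (σ t : ℝ) : ℝ := t ^ (σ - 1) / Real.Gamma σ

/-- The `(r, m)` term of `mlKernel`. -/
def mlTerm (α δ lam : ℝ) (b : ℂ) (σ t : ℝ) (p : ℕ × ℕ) : ℂ :=
  mlCoeff lam b p * (rlKernel (mlExp α δ p + σ) t : ℂ)

/-- The function with Laplace transform `s^{-σ} / (1 + λ s^{-δ} + b s^{-α})`, expanded in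
powers of `s^{-1}`. -/
def mlKernel (α δ lam : ℝ) (b : ℂ) (σ t : ℝ) : ℂ := ∑' p, mlTerm α δ lam b σ t p

theorem mlExp_nonneg {α δ : ℝ} (hα : 0 ≤ α) (hδ : 0 ≤ δ) (p : ℕ × ℕ) : 0 ≤ mlExp α δ p := by
  unfold mlExp; positivity

/-- Restricting Euler's integral to `(s, ∞)` bounds `Γ` from below. -/
theorem inv_Gamma_le {x s : ℝ} (hx : 0 < x) (hs : 1 ≤ s) :
    (Real.Gamma x)⁻¹ ≤ s ^ (1 - x) * Real.exp s := by
  have hs0 : 0 < s := by linarith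
  -- For `y ≥ 1` the factor `u ^ (y - 1)` is at least `s ^ (y - 1)` on `(s, ∞)`.
  have key : ∀ y : ℝ, 1 ≤ y → s ^ (y - 1) * Real.exp (-s) ≤ Real.Gamma y := by
    intro y hy
    rw [Real.Gamma_eq_integral (by linarith), ← integral_exp_neg_Ioi s, ← integral_const_mul]
    have hi := Real.GammaIntegral_convergent (s := y) (by linarith)
    refine le_trans ?_ (setIntegral_mono_set hi ?_
      (Set.Ioi_subset_Ioi hs0.le).eventuallyLE)
    · refine setIntegral_mono_on ?_ (hi.mono_set (Set.Ioi_subset_Ioi hs0.le)) measurableSet_Ioi ?_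
      · exact (integrableOn_exp_neg_Ioi s).const_mul _
      · intro u hu
        have hu' : s < u := hu
        rw [mul_comm]
        gcongr
    · filter_upwards [ae_restrict_mem measurableSet_Ioi] with u hu
      have : (0 : ℝ) < u := hu
      simp only [Pi.zero_apply]
      positivity
  have h1 : s ^ (x - 1) * Real.exp (-s) ≤ Real.Gamma x := by
    rcases le_or_gt 1 x with h | h
    · exact key x h
    -- For `x < 1`, use `Γ(x) ≥ x Γ(x) = Γ(x + 1)`.
    · have h2 := key (x + 1) (by linarith)
      rw [Real.Gamma_add_one hx.ne', add_sub_cancel_right] at h2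
      have h3 : s ^ (x - 1) ≤ s ^ x := Real.rpow_le_rpow_of_exponent_le hs (by linarith)
      have h4 : x * Real.Gamma x ≤ Real.Gamma x := by
        nlinarith [Real.Gamma_pos_of_pos hx]
      calc _ ≤ s ^ x * Real.exp (-s) := by gcongr
        _ ≤ _ := h2.trans h4
  rw [show s ^ (1 - x) * Real.exp s = (s ^ (x - 1) * Real.exp (-s))⁻¹ by
    rw [mul_inv, ← Real.rpow_neg hs0.le, Real.exp_neg, inv_inv, neg_sub]]
  exact inv_anti₀ (by positivity) h1

/-- `∑_{r,m} C(r+m, m) x^r y^m = 1 / (1 - x - y)`. -/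
theorem hasSum_choose_prod {x y : ℝ} (hx : 0 ≤ x) (hy : 0 ≤ y) (hxy : x + y < 1) :
    HasSum (fun p : ℕ × ℕ => x ^ p.1 * ((p.1 + p.2).choose p.2 : ℝ) * y ^ p.2)
      (1 / (1 - x - y)) := by
  have hy1 : ‖y‖ < 1 := by rw [Real.norm_of_nonneg hy]; linarith
  have hy2 : 0 < 1 - y := by linarith
  have hrow : ∀ r : ℕ, HasSum (fun m : ℕ => x ^ r * ((r + m).choose m : ℝ) * y ^ m)
      (1 / (1 - y) * (x / (1 - y)) ^ r) := by
    intro r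
    have h := (hasSum_choose_mul_geometric_of_norm_lt_one r hy1).mul_left (x ^ r)
    have h1 : x ^ r * (1 / (1 - y) ^ (r + 1)) = 1 / (1 - y) * (x / (1 - y)) ^ r := by
      rw [div_pow, pow_succ]
      field_simp
    rw [h1] at h
    refine h.congr_fun fun m => ?_
    rw [mul_assoc, add_comm r m, Nat.choose_symm_add]
  have hcol : HasSum (fun r : ℕ => 1 / (1 - y) * (x / (1 - y)) ^ r) (1 / (1 - x - y)) := by
    have h := (hasSum_geometric_of_lt_one (r := x / (1 - y)) (by positivity)
      (by rw [div_lt_one hy2]; linarith)).mul_left (1 / (1 - y))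
    have h1 : 1 / (1 - y) * (1 - x / (1 - y))⁻¹ = 1 / (1 - x - y) := by
      rw [one_sub_div hy2.ne', inv_div, one_div_mul_eq_div, div_div_cancel_left' hy2.ne',
        one_div, show 1 - y - x = 1 - x - y by ring]
    rwa [h1] at h
  have hs : Summable (fun p : ℕ × ℕ => x ^ p.1 * ((p.1 + p.2).choose p.2 : ℝ) * y ^ p.2) := by
    rw [summable_prod_of_nonneg (fun p => by positivity)]
    refine ⟨fun r => (hrow r).summable, ?_⟩
    exact hcol.summable.congr fun r => (hrow r).tsum_eq.symm
  have := hs.hasSum.prod_fiberwise hrow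
  rw [← this.unique hcol]
  exact hs.hasSum

/-- `inv_Gamma_le` turns the terms of the double series into those of `hasSum_choose_prod`. -/
theorem norm_mlTerm_le {α δ lam : ℝ} {b : ℂ} {B σ T s t : ℝ} (hα : 0 ≤ α) (hδ : 0 ≤ δ)
    (hσ : 0 < σ) (hb : ‖b‖ ≤ B) (hs : 1 ≤ s) (ht : 0 < t) (htT : t ≤ T) (p : ℕ × ℕ) :
    ‖mlTerm α δ lam b σ t p‖ ≤ t ^ (σ - 1) * (s ^ (1 - σ) * Real.exp s *
      ((|lam| * (T / s) ^ δ) ^ p.1 * ((p.1 + p.2).choose p.2 : ℝ) * (B * (T / s) ^ α) ^ p.2)) := by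
  have hs0 : 0 < s := by linarith
  have hT : 0 < T := by linarith
  have he := mlExp_nonneg hα hδ p
  set e := mlExp α δ p with hedef
  have hB : 0 ≤ B := (norm_nonneg b).trans hb
  have h1 : ‖mlTerm α δ lam b σ t p‖ =
      |lam| ^ p.1 * ((p.1 + p.2).choose p.2 : ℝ) * ‖b‖ ^ p.2 *
        (t ^ (σ - 1) * t ^ e * (Real.Gamma (e + σ))⁻¹) := by
    have hG : 0 < Real.Gamma (e + σ) := Real.Gamma_pos_of_pos (by linarith)
    rw [mlTerm, mlCoeff, rlKernel, ← hedef]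
    simp only [norm_mul, norm_pow, norm_neg, Complex.norm_real, Complex.norm_natCast,
      Real.norm_eq_abs]
    rw [abs_of_nonneg (by positivity : 0 ≤ t ^ (e + σ - 1) / Real.Gamma (e + σ)),
      ← Real.rpow_add ht, div_eq_mul_inv]
    congr 3
    ring
  have h2 : (T / s) ^ e = ((T / s) ^ α) ^ p.2 * ((T / s) ^ δ) ^ p.1 := by
    rw [hedef, mlExp, Real.rpow_add (by positivity), Real.rpow_mul (by positivity),
      Real.rpow_mul (by positivity), Real.rpow_natCast, Real.rpow_natCast]
  have h3 : (Real.Gamma (e + σ))⁻¹ ≤ s ^ (1 - (e + σ)) * Real.exp s :=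
    inv_Gamma_le (by linarith) hs
  calc ‖mlTerm α δ lam b σ t p‖
      ≤ |lam| ^ p.1 * ((p.1 + p.2).choose p.2 : ℝ) * B ^ p.2 *
        (t ^ (σ - 1) * T ^ e * (s ^ (1 - (e + σ)) * Real.exp s)) := by
        rw [h1]
        have : 0 ≤ (Real.Gamma (e + σ))⁻¹ :=
          inv_nonneg.2 (Real.Gamma_pos_of_pos (by linarith)).le
        gcongr
    _ = t ^ (σ - 1) * (s ^ (1 - σ) * Real.exp s * (|lam| ^ p.1 *
          ((p.1 + p.2).choose p.2 : ℝ) * B ^ p.2 * (T / s) ^ e)) := by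
        rw [Real.div_rpow hT.le hs0.le, show 1 - (e + σ) = (1 - σ) - e by ring,
          Real.rpow_sub hs0]
        field_simp
    _ = _ := by rw [h2]; ring

/-- A scale `s` proportional to `1 + B^{1/α}` keeps the geometric ratio of the double series
away from one, uniformly in `B`. -/
theorem exists_scale {α δ lam T : ℝ} (hα : 0 < α) (hδ : 0 ≤ δ) (hlam : δ = 0 → |lam| < 1)
    (hT : 0 < T) : ∃ c ρ : ℝ, 1 ≤ c ∧ ρ < 1 ∧ ∀ B : ℝ, 0 ≤ B →
      |lam| * (T / (c * (1 + B ^ (1 / α)))) ^ δ + B * (T / (c * (1 + B ^ (1 / α)))) ^ α ≤ ρ := by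
  have hlim0 : Tendsto (fun c : ℝ => T / c) atTop (𝓝 0) := tendsto_const_nhds.div_atTop tendsto_id
  have hlim : ∀ ε : ℝ, 0 < ε → Tendsto (fun c : ℝ => (T / c) ^ ε) atTop (𝓝 0) := by
    intro ε hε
    have := hlim0.rpow_const (p := ε) (Or.inr hε.le)
    rwa [Real.zero_rpow hε.ne'] at this
  obtain ⟨l, hl, hlt⟩ : ∃ l : ℝ, l < 1 ∧
      Tendsto (fun c : ℝ => |lam| * (T / c) ^ δ + (T / c) ^ α) atTop (𝓝 l) := by
    rcases hδ.eq_or_lt with h | h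
    · refine ⟨|lam|, hlam h.symm, ?_⟩
      have := (tendsto_const_nhds (x := |lam|)).add (hlim α hα)
      simpa [← h] using this
    · refine ⟨0, one_pos, ?_⟩
      simpa using ((hlim δ h).const_mul |lam|).add (hlim α hα)
  obtain ⟨c, hc, hc1⟩ := ((hlt.eventually_lt_const (show l < (l + 1) / 2 by linarith)).and
    (eventually_ge_atTop 1)).exists
  refine ⟨c, (l + 1) / 2, hc1, by linarith, fun B hB => ?_⟩
  have hc0 : 0 < c := by linarith
  set D := 1 + B ^ (1 / α) with hD
  have hBp : 0 ≤ B ^ (1 / α) := by positivity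
  have hD1 : 1 ≤ D := by linarith
  have hD0 : 0 < D := by linarith
  have hBD : B ≤ D ^ α := by
    calc B = (B ^ (1 / α)) ^ α := by
          rw [← Real.rpow_mul hB, one_div_mul_cancel hα.ne', Real.rpow_one]
      _ ≤ D ^ α := by
          apply Real.rpow_le_rpow hBp _ hα.le
          linarith
  have h1 : (T / (c * D)) ^ δ ≤ (T / c) ^ δ := by
    apply Real.rpow_le_rpow (by positivity) _ hδ
    gcongr
    nlinarith
  have h2 : B * (T / (c * D)) ^ α ≤ (T / c) ^ α := by
    rw [show T / (c * D) = (T / c) / D by field_simp, Real.div_rpow (by positivity) hD0.le]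
    calc _ ≤ D ^ α * ((T / c) ^ α / D ^ α) := by gcongr
      _ = _ := by field_simp
  refine le_trans (add_le_add (mul_le_mul_of_nonneg_left h1 (abs_nonneg _)) h2) hc.le

/-- The double series of `mlKernel` is dominated by a convergent series on `(0, T]`, whose sum
grows at most like `exp(c B^{1/α})` when `‖b‖ ≤ B`. -/
theorem exists_mlTerm_bound {α δ lam σ T : ℝ} (hα : 0 < α) (hδ : 0 ≤ δ)
    (hlam : δ = 0 → |lam| < 1) (hσ : 0 < σ) (hT : 0 < T) :
    ∃ C c : ℝ, 0 ≤ C ∧ 0 < c ∧ ∀ B : ℝ, 0 ≤ B → ∃ d : ℕ × ℕ → ℝ, (∀ p, 0 ≤ d p) ∧ Summable d ∧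
      ∑' p, d p ≤ C * Real.exp (c * B ^ (1 / α)) ∧
      ∀ b : ℂ, ‖b‖ ≤ B → ∀ t : ℝ, 0 < t → t ≤ T → ∀ p,
        ‖mlTerm α δ lam b σ t p‖ ≤ t ^ (σ - 1) * d p := by
  obtain ⟨c, ρ, hc, hρ, h⟩ := exists_scale hα hδ hlam hT
  have hρ' : 0 < 1 - ρ := by linarith
  refine ⟨Real.exp (2 * c) / (1 - ρ), 2 * c, by positivity, by linarith, fun B hB => ?_⟩
  have hBp : 0 ≤ B ^ (1 / α) := by positivity
  set s := c * (1 + B ^ (1 / α)) with hs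
  have hs1 : 1 ≤ s := by nlinarith
  have hs0 : 0 < s := by linarith
  have hq := h B hB
  have hsum := (hasSum_choose_prod (x := |lam| * (T / s) ^ δ) (y := B * (T / s) ^ α)
    (by positivity) (by positivity) (by linarith)).mul_left (s ^ (1 - σ) * Real.exp s)
  refine ⟨_, fun p => by positivity, hsum.summable, ?_, fun b hb t ht htT p =>
    norm_mlTerm_le hα.le hδ hσ hb hs1 ht htT p⟩
  rw [hsum.tsum_eq]
  have h1 : s ^ (1 - σ) ≤ Real.exp s := by
    calc s ^ (1 - σ) ≤ s ^ (1 : ℝ) := Real.rpow_le_rpow_of_exponent_le hs1 (by linarith)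
      _ = s := Real.rpow_one s
      _ ≤ Real.exp s := by linarith [Real.add_one_le_exp s]
  have h2 : 1 / (1 - |lam| * (T / s) ^ δ - B * (T / s) ^ α) ≤ 1 / (1 - ρ) :=
    one_div_le_one_div_of_le (by linarith) (by linarith)
  calc _ ≤ Real.exp s * Real.exp s * (1 / (1 - ρ)) := by
        have h3 : 0 ≤ 1 / (1 - |lam| * (T / s) ^ δ - B * (T / s) ^ α) := by
          apply one_div_nonneg.2; linarith
        gcongr
    _ = _ := by
        rw [← Real.exp_add, show s + s = 2 * c + 2 * c * B ^ (1 / α) by rw [hs]; ring,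
          Real.exp_add]
        ring

theorem summable_mlTerm {α δ lam σ t : ℝ} (hα : 0 < α) (hδ : 0 ≤ δ)
    (hlam : δ = 0 → |lam| < 1) (hσ : 0 < σ) (ht : 0 < t) (b : ℂ) :
    Summable (mlTerm α δ lam b σ t) := by
  obtain ⟨C, c, -, -, h⟩ := exists_mlTerm_bound (lam := lam) hα hδ hlam hσ ht
  obtain ⟨d, -, hd, -, h⟩ := h ‖b‖ (norm_nonneg b)
  exact (hd.mul_left _).of_norm_bounded (h b le_rfl t ht le_rfl)

theorem ascPochhammer_div_factorial (r m : ℕ) :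
    (ascPochhammer ℝ m).eval ((r : ℝ) + 1) / (m.factorial : ℝ) = ((r + m).choose m : ℝ) := by
  have h1 : (ascPochhammer ℝ m).eval ((r : ℝ) + 1) = ((r + 1).ascFactorial m : ℝ) := by
    rw [← ascPochhammer_nat_eq_ascFactorial, ascPochhammer_eval_cast]
    push_cast
    rfl
  rw [h1, Nat.ascFactorial_eq_factorial_mul_choose]
  push_cast
  field_simp

/-- Summing `mlKernel` over `m` for fixed `r` gives a Prabhakar function. -/
theorem tsum_mlTerm_row {α δ lam σ t : ℝ} (ht : 0 < t) (b : ℂ) (r : ℕ) :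
    ∑' m, mlTerm α δ lam b σ t (r, m) =
      (-(lam : ℂ)) ^ r * ((t ^ (δ * r + σ - 1) : ℝ) : ℂ) *
        mittagLeffler α (σ + δ * r) (r + 1) (-b * ((t ^ α : ℝ) : ℂ)) := by
  rw [mittagLeffler, ← tsum_mul_left]
  congr 1
  funext m
  rw [mlTerm, mlCoeff, rlKernel, mlExp, mul_pow, ← Complex.ofReal_pow, ← Real.rpow_natCast,
    ← Real.rpow_mul ht.le, div_mul_eq_div_div_swap, ascPochhammer_div_factorial,
    show α * (m : ℝ) + δ * (r : ℝ) + σ - 1 = (δ * r + σ - 1) + α * m by ring,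
    Real.rpow_add ht, show α * (m : ℝ) + (σ + δ * r) = α * m + δ * r + σ by ring]
  push_cast
  ring

theorem hasSum_mittagLeffler {α δ lam σ t : ℝ} (hα : 0 < α) (hδ : 0 ≤ δ)
    (hlam : δ = 0 → |lam| < 1) (hσ : 0 < σ) (ht : 0 < t) (b : ℂ) :
    HasSum (fun r : ℕ => (-(lam : ℂ)) ^ r * ((t ^ (δ * r + σ - 1) : ℝ) : ℂ) *
        mittagLeffler α (σ + δ * r) (r + 1) (-b * ((t ^ α : ℝ) : ℂ)))
      (mlKernel α δ lam b σ t) := by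
  have hs := summable_mlTerm hα hδ hlam hσ ht b
  have := hs.hasSum.prod_fiberwise fun r => (hs.prod_factor r).hasSum
  simpa only [tsum_mlTerm_row ht, mlKernel] using this

/-! ### Riemann-Liouville integrals -/

theorem rlKernel_one (t : ℝ) : rlKernel 1 t = 1 := by simp [rlKernel]

theorem rlKernel_two (t : ℝ) : rlKernel 2 t = t := by
  rw [rlKernel, Real.Gamma_two]; norm_num

theorem measurable_rlKernel (σ : ℝ) : Measurable (rlKernel σ) := by
  unfold rlKernel; fun_prop

theorem rlKernel_nonneg {σ t : ℝ} (hσ : 0 < σ) (ht : 0 ≤ t) : 0 ≤ rlKernel σ t :=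
  div_nonneg (Real.rpow_nonneg ht _) (Real.Gamma_pos_of_pos hσ).le

theorem rlKernel_pos {σ t : ℝ} (hσ : 0 < σ) (ht : 0 < t) : 0 < rlKernel σ t :=
  div_pos (Real.rpow_pos_of_pos ht _) (Real.Gamma_pos_of_pos hσ)

theorem rlKernel_le {σ t T : ℝ} (hσ : 1 ≤ σ) (ht : 0 ≤ t) (htT : t ≤ T) :
    rlKernel σ t ≤ rlKernel σ T := by
  have := Real.Gamma_pos_of_pos (show 0 < σ by linarith)
  unfold rlKernel
  gcongr

theorem rlIntegral_eq {σ : ℝ} (hσ : σ ≠ 0) (u : ℝ → ℂ) (t : ℝ) :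
    rlIntegral σ u t = ∫ s in (0 : ℝ)..t, (rlKernel σ (t - s) : ℂ) * u s := by
  rw [rlIntegral, if_neg hσ, ← intervalIntegral.integral_const_mul]
  congr 1
  funext s
  rw [rlKernel]
  push_cast
  ring

theorem rlIntegral_zero (u : ℝ → ℂ) : rlIntegral 0 u = u := by
  funext t; simp [rlIntegral]

/-- Euler's beta integral: the kernels form a convolution semigroup. -/
theorem integral_rlKernel_mul {p q t : ℝ} (hp : 0 < p) (hq : 0 < q) (ht : 0 < t) :
    ∫ s in (0 : ℝ)..t, rlKernel p (t - s) * rlKernel q s = rlKernel (p + q) t := by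
  have h1 := Complex.betaIntegral_scaled (q : ℂ) (p : ℂ) ht
  have h2 := Complex.Gamma_mul_Gamma_eq_betaIntegral (s := (q : ℂ)) (t := (p : ℂ))
    (by simpa) (by simpa)
  have hG : Complex.Gamma ((q : ℂ) + p) ≠ 0 := by
    rw [← Complex.ofReal_add, Complex.Gamma_ofReal]
    exact_mod_cast (Real.Gamma_pos_of_pos (by linarith : 0 < q + p)).ne'
  have h3 : ∫ x in (0 : ℝ)..t, (x : ℂ) ^ ((q : ℂ) - 1) * ((t : ℂ) - x) ^ ((p : ℂ) - 1) =
      ((∫ x in (0 : ℝ)..t, x ^ (q - 1) * (t - x) ^ (p - 1) : ℝ) : ℂ) := by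
    rw [← intervalIntegral.integral_ofReal]
    refine intervalIntegral.integral_congr fun x hx => ?_
    rw [Set.uIcc_of_le ht.le] at hx
    rw [Complex.ofReal_mul, Complex.ofReal_cpow hx.1, Complex.ofReal_cpow (by linarith [hx.2])]
    push_cast
    rfl
  have h4 : Complex.betaIntegral q p =
      ((Real.Gamma q * Real.Gamma p / Real.Gamma (q + p) : ℝ) : ℂ) := by
    rw [← mul_right_inj' hG, ← h2, ← Complex.ofReal_add]
    simp only [Complex.Gamma_ofReal]
    rw [← Complex.ofReal_mul, ← Complex.ofReal_mul, mul_div_cancel₀]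
    exact (Real.Gamma_pos_of_pos (by linarith : 0 < q + p)).ne'
  rw [h3, h4, show (t : ℂ) ^ ((q : ℂ) + p - 1) = ((t ^ (q + p - 1) : ℝ) : ℂ) by
    rw [Complex.ofReal_cpow ht.le]; push_cast; rfl, ← Complex.ofReal_mul] at h1
  have h5 := Complex.ofReal_injective h1
  have hGp := Real.Gamma_pos_of_pos hp
  have hGq := Real.Gamma_pos_of_pos hq
  have h6 : ∀ s, rlKernel p (t - s) * rlKernel q s =
      (Real.Gamma p * Real.Gamma q)⁻¹ * (s ^ (q - 1) * (t - s) ^ (p - 1)) := by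
    intro s
    simp only [rlKernel]
    field_simp
  simp only [h6]
  rw [intervalIntegral.integral_const_mul, h5, rlKernel, add_comm p q]
  field_simp

theorem integral_rlKernel_mul_shift {p q s T : ℝ} (hp : 0 < p) (hq : 0 < q) (hs : s < T) :
    ∫ t in s..T, rlKernel p (T - t) * rlKernel q (t - s) = rlKernel (p + q) (T - s) := by
  rw [← integral_rlKernel_mul hp hq (sub_pos.2 hs)]
  have := intervalIntegral.integral_comp_sub_right
    (fun t => rlKernel p (T - s - t) * rlKernel q t) s (a := s) (b := T)
  rw [sub_self] at this
  rw [← this]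
  congr 1
  funext t
  rw [show T - s - (t - s) = T - t by ring]

theorem intervalIntegrable_rlKernel_mul_shift {p q s T : ℝ} (hp : 0 < p) (hq : 0 < q)
    (hs : s < T) :
    IntervalIntegrable (fun t => rlKernel p (T - t) * rlKernel q (t - s)) volume s T := by
  -- A non-integrable function would have integral zero.
  refine intervalIntegral.intervalIntegrable_of_integral_ne_zero ?_
  rw [integral_rlKernel_mul_shift hp hq hs]
  exact (rlKernel_pos (by linarith) (by linarith)).ne'

theorem intervalIntegrable_rlKernel_mul {σ T : ℝ} {u : ℝ → ℂ} (hσ : 1 ≤ σ) (hT : 0 < T)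
    (hu : IntegrableOn u (Set.Ioc 0 T)) :
    IntervalIntegrable (fun s => (rlKernel σ (T - s) : ℂ) * u s) volume 0 T := by
  rw [intervalIntegrable_iff_integrableOn_Ioc_of_le hT.le]
  refine Integrable.bdd_mul (c := rlKernel σ T) hu ?_ ?_
  · have := (measurable_rlKernel σ).comp
      (measurable_const.sub measurable_id : Measurable fun s => T - s)
    exact (Complex.measurable_ofReal.comp this).aestronglyMeasurable
  · filter_upwards [ae_restrict_mem measurableSet_Ioc] with s hs
    rw [Complex.norm_real, Real.norm_of_nonneg (rlKernel_nonneg (by linarith) (by linarith [hs.2]))]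
    exact rlKernel_le hσ (by linarith [hs.2]) (by linarith [hs.1])

/-- Absolute convergence of the double integral behind the semigroup property. -/
theorem integrable_semigroup {p q T : ℝ} {u : ℝ → ℂ} (hp : 0 < p) (hq : 0 < q) (hpq : 1 ≤ p + q)
    (hT : 0 < T) (hu : IntegrableOn u (Set.Ioc 0 T)) :
    Integrable (fun z : ℝ × ℝ => (rlKernel p (T - z.1) : ℂ) *
      ((Set.Ioi z.2).indicator (fun t => (rlKernel q (t - z.2) : ℂ)) z.1 * u z.2))
      ((volume.restrict (Set.Ioc 0 T)).prod (volume.restrict (Set.Ioc 0 T))) := by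
  have hmeas : AEStronglyMeasurable (fun z : ℝ × ℝ => (rlKernel p (T - z.1) : ℂ) *
      ((Set.Ioi z.2).indicator (fun t => (rlKernel q (t - z.2) : ℂ)) z.1 * u z.2))
      ((volume.restrict (Set.Ioc 0 T)).prod (volume.restrict (Set.Ioc 0 T))) := by
    refine AEStronglyMeasurable.mul ?_ (AEStronglyMeasurable.mul ?_ ?_)
    · exact (Complex.measurable_ofReal.comp ((measurable_rlKernel p).comp
        (by fun_prop : Measurable fun z : ℝ × ℝ => T - z.1))).aestronglyMeasurable
    · have h1 : (fun z : ℝ × ℝ => (Set.Ioi z.2).indicator (fun t => (rlKernel q (t - z.2) : ℂ)) z.1)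
          = {z : ℝ × ℝ | z.2 < z.1}.indicator (fun z => (rlKernel q (z.1 - z.2) : ℂ)) := by
        funext z
        simp [Set.indicator_apply]
      rw [h1]
      refine Measurable.aestronglyMeasurable (Measurable.indicator ?_
        (measurableSet_lt measurable_snd measurable_fst))
      exact Complex.measurable_ofReal.comp ((measurable_rlKernel q).comp
        (by fun_prop : Measurable fun z : ℝ × ℝ => z.1 - z.2))
    · exact hu.1.comp_snd
  rw [integrable_prod_iff' hmeas]
  have hlt : ∀ᵐ s ∂(volume.restrict (Set.Ioc 0 T)), s ∈ Set.Ioo 0 T := by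
    rw [← restrict_Ioo_eq_restrict_Ioc]
    exact ae_restrict_mem measurableSet_Ioo
  have hset : ∀ s ∈ Set.Ioo 0 T, Set.Ioi s ∩ Set.Ioc 0 T = Set.Ioc s T := by
    intro s hs
    ext t
    simp only [Set.mem_inter_iff, Set.mem_Ioi, Set.mem_Ioc]
    constructor
    · rintro ⟨h1, -, h2⟩; exact ⟨h1, h2⟩
    · rintro ⟨h1, h2⟩; exact ⟨h1, by linarith [hs.1], h2⟩
  have hform : ∀ s t : ℝ, (rlKernel p (T - t) : ℂ) *
      ((Set.Ioi s).indicator (fun t => (rlKernel q (t - s) : ℂ)) t * u s) =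
      (Set.Ioi s).indicator
        (fun t => ((rlKernel p (T - t) * rlKernel q (t - s) : ℝ) : ℂ) * u s) t := by
    intro s t
    by_cases h : t ∈ Set.Ioi s
    · simp only [Set.indicator_of_mem h]; push_cast; ring
    · simp only [Set.indicator_of_notMem h]; ring
  constructor
  · filter_upwards [hlt] with s hs
    simp only [hform]
    rw [integrable_indicator_iff measurableSet_Ioi, IntegrableOn,
      Measure.restrict_restrict measurableSet_Ioi, hset s hs]
    have := (intervalIntegrable_rlKernel_mul_shift hp hq hs.2)
    rw [intervalIntegrable_iff_integrableOn_Ioc_of_le hs.2.le] at this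
    exact this.ofReal.mul_const _
  · have hb := (intervalIntegrable_rlKernel_mul hpq hT hu).norm
    rw [intervalIntegrable_iff_integrableOn_Ioc_of_le hT.le] at hb
    refine Integrable.congr hb ?_
    filter_upwards [hlt] with s hs
    simp only [hform, norm_indicator_eq_indicator_norm]
    rw [integral_indicator measurableSet_Ioi, Measure.restrict_restrict measurableSet_Ioi,
      hset s hs, ← intervalIntegral.integral_of_le hs.2.le]
    have : ∫ t in s..T, ‖((rlKernel p (T - t) * rlKernel q (t - s) : ℝ) : ℂ) * u s‖ =
        ∫ t in s..T, (rlKernel p (T - t) * rlKernel q (t - s)) * ‖u s‖ := by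
      refine intervalIntegral.integral_congr fun t ht => ?_
      rw [Set.uIcc_of_le hs.2.le] at ht
      rw [norm_mul, Complex.norm_real, Real.norm_of_nonneg]
      exact mul_nonneg (rlKernel_nonneg hp (by linarith [ht.2]))
        (rlKernel_nonneg hq (by linarith [ht.1]))
    rw [this, intervalIntegral.integral_mul_const, integral_rlKernel_mul_shift hp hq hs.2,
      norm_mul, Complex.norm_real,
      Real.norm_of_nonneg (rlKernel_nonneg (by linarith) (by linarith [hs.2]))]

theorem integral_indicator_rlKernel {q T t : ℝ} (hq : q ≠ 0) (u : ℝ → ℂ) (ht : t ∈ Set.Ioc 0 T) :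
    ∫ s in Set.Ioc 0 T, (Set.Ioi s).indicator (fun t => (rlKernel q (t - s) : ℂ)) t * u s =
      rlIntegral q u t := by
  have h1 : ∀ s, (Set.Ioi s).indicator (fun t => (rlKernel q (t - s) : ℂ)) t * u s =
      (Set.Iio t).indicator (fun s => (rlKernel q (t - s) : ℂ) * u s) s := by
    intro s
    by_cases h : s < t
    · rw [Set.indicator_of_mem (show t ∈ Set.Ioi s from h),
        Set.indicator_of_mem (show s ∈ Set.Iio t from h)]
    · rw [Set.indicator_of_notMem (show t ∉ Set.Ioi s from h),
        Set.indicator_of_notMem (show s ∉ Set.Iio t from h), zero_mul]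
  have h2 : Set.Iio t ∩ Set.Ioc 0 T = Set.Ioo 0 t := by
    ext s
    simp only [Set.mem_inter_iff, Set.mem_Iio, Set.mem_Ioc, Set.mem_Ioo]
    constructor
    · rintro ⟨h1, h2, -⟩; exact ⟨h2, h1⟩
    · rintro ⟨h1, h2⟩; exact ⟨h2, h1, by linarith [ht.2]⟩
  simp only [h1]
  rw [integral_indicator measurableSet_Iio, Measure.restrict_restrict measurableSet_Iio, h2,
    rlIntegral_eq hq, intervalIntegral.integral_of_le ht.1.le, restrict_Ioo_eq_restrict_Ioc]

theorem intervalIntegrable_rlKernel_mul_rlIntegral {p q T : ℝ} {u : ℝ → ℂ} (hp : 0 < p)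
    (hq : 0 ≤ q) (hpq : 1 ≤ p + q) (hT : 0 < T) (hu : IntegrableOn u (Set.Ioc 0 T)) :
    IntervalIntegrable (fun t => (rlKernel p (T - t) : ℂ) * rlIntegral q u t) volume 0 T := by
  rcases hq.eq_or_lt with rfl | hq
  · rw [rlIntegral_zero]
    exact intervalIntegrable_rlKernel_mul (by linarith) hT hu
  · rw [intervalIntegrable_iff_integrableOn_Ioc_of_le hT.le]
    refine Integrable.congr (integrable_semigroup hp hq hpq hT hu).integral_prod_left ?_
    filter_upwards [ae_restrict_mem measurableSet_Ioc] with t ht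
    rw [integral_const_mul, integral_indicator_rlKernel hq.ne' u ht]

/-- The semigroup property of Riemann-Liouville integrals, pointwise once the total order is at
least one. -/
theorem rlIntegral_rlIntegral {p q T : ℝ} {u : ℝ → ℂ} (hp : 0 < p) (hq : 0 ≤ q)
    (hpq : 1 ≤ p + q) (hT : 0 < T) (hu : IntegrableOn u (Set.Ioc 0 T)) :
    ∫ t in (0 : ℝ)..T, (rlKernel p (T - t) : ℂ) * rlIntegral q u t = rlIntegral (p + q) u T := by
  rcases hq.eq_or_lt with rfl | hq
  · rw [rlIntegral_zero, add_zero, rlIntegral_eq hp.ne']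
  · have h := integral_integral_swap (f := fun t s => (rlKernel p (T - t) : ℂ) *
      ((Set.Ioi s).indicator (fun t => (rlKernel q (t - s) : ℂ)) t * u s))
      (integrable_semigroup hp hq hpq hT hu)
    rw [intervalIntegral.integral_of_le hT.le, rlIntegral_eq (by linarith),
      intervalIntegral.integral_of_le hT.le]
    refine Eq.trans ?_ (h.trans ?_)
    · refine setIntegral_congr_fun measurableSet_Ioc fun t ht => ?_
      rw [integral_const_mul, integral_indicator_rlKernel hq.ne' u ht]
    · rw [← restrict_Ioo_eq_restrict_Ioc]
      refine setIntegral_congr_fun measurableSet_Ioo fun s hs => ?_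
      have hset : Set.Ioi s ∩ Set.Ioo 0 T = Set.Ioo s T := by
        ext t
        simp only [Set.mem_inter_iff, Set.mem_Ioi, Set.mem_Ioo]
        constructor
        · rintro ⟨h1, -, h2⟩; exact ⟨h1, h2⟩
        · rintro ⟨h1, h2⟩; exact ⟨h1, by linarith [hs.1], h2⟩
      have hform : ∀ t : ℝ, (rlKernel p (T - t) : ℂ) *
          ((Set.Ioi s).indicator (fun t => (rlKernel q (t - s) : ℂ)) t * u s) =
          (Set.Ioi s).indicator
            (fun t => ((rlKernel p (T - t) * rlKernel q (t - s) : ℝ) : ℂ) * u s) t := by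
        intro t
        by_cases h : t ∈ Set.Ioi s
        · simp only [Set.indicator_of_mem h]; push_cast; ring
        · simp only [Set.indicator_of_notMem h]; ring
      simp only [hform]
      rw [integral_indicator measurableSet_Ioi, Measure.restrict_restrict measurableSet_Ioi, hset,
        restrict_Ioo_eq_restrict_Ioc, integral_mul_const, integral_complex_ofReal,
        ← intervalIntegral.integral_of_le hs.2.le, integral_rlKernel_mul_shift hp hq hs.2]

/-! ### Convolution with the double series -/

/-- Pascal's rule in summed form: `∑ c_p (1 + λ u + b v) u^r v^m = 1`, with `u` and `v` acting as
the shifts of a function by `δ` and `α`. -/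
theorem pascal_sum {α δ lam : ℝ} {b : ℂ} {A : ℝ → ℂ} {S₀ S₁ S₂ : ℂ}
    (h₀ : HasSum (fun p => mlCoeff lam b p * A (mlExp α δ p)) S₀)
    (h₁ : HasSum (fun p => mlCoeff lam b p * A (mlExp α δ p + δ)) S₁)
    (h₂ : HasSum (fun p => mlCoeff lam b p * A (mlExp α δ p + α)) S₂) :
    S₀ + lam * S₁ + b * S₂ = A 0 := by
  -- The second and third series, re-indexed by the total powers of `u` and `v`.
  let T₁ : ℕ × ℕ → ℂ := fun p => if p.1 = 0 then 0 else
    lam * (mlCoeff lam b (p.1 - 1, p.2) * A (mlExp α δ (p.1 - 1, p.2) + δ))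
  let T₂ : ℕ × ℕ → ℂ := fun p => if p.2 = 0 then 0 else
    b * (mlCoeff lam b (p.1, p.2 - 1) * A (mlExp α δ (p.1, p.2 - 1) + α))
  have hT₁ : HasSum T₁ (lam * S₁) := by
    have hinj : Function.Injective fun p : ℕ × ℕ => (p.1 + 1, p.2) := by
      rintro ⟨a, b⟩ ⟨c, d⟩ h
      simp only [Prod.mk.injEq, add_left_inj] at h
      exact Prod.ext h.1 h.2
    rw [← hinj.hasSum_iff]
    · exact h₁.mul_left _
    · rintro ⟨r, m⟩ hp
      rcases r with _ | r
      · simp [T₁]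
      · exact absurd ⟨(r, m), rfl⟩ hp
  have hT₂ : HasSum T₂ (b * S₂) := by
    have hinj : Function.Injective fun p : ℕ × ℕ => (p.1, p.2 + 1) := by
      rintro ⟨a, b⟩ ⟨c, d⟩ h
      simp only [Prod.mk.injEq, add_left_inj] at h
      exact Prod.ext h.1 h.2
    rw [← hinj.hasSum_iff]
    · exact h₂.mul_left _
    · rintro ⟨r, m⟩ hp
      rcases m with _ | m
      · simp [T₂]
      · exact absurd ⟨(r, m), rfl⟩ hp
  have hsum := (h₀.add hT₁).add hT₂
  refine hsum.unique ((hasSum_ite_eq ((0, 0) : ℕ × ℕ) (A 0)).congr_fun ?_)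
  rintro ⟨r, m⟩
  rcases r with _ | r <;> rcases m with _ | m
  · simp [T₁, T₂, mlCoeff, mlExp]
  · have e2 : mlExp α δ (0, m) + α = mlExp α δ (0, m + 1) := by
      simp only [mlExp]; push_cast; ring
    simp [T₁, T₂, e2]
    simp [mlCoeff]
    ring
  · have e1 : mlExp α δ (r, 0) + δ = mlExp α δ (r + 1, 0) := by
      simp only [mlExp]; push_cast; ring
    simp [T₁, T₂, e1]
    simp [mlCoeff]
    ring
  · have e1 : mlExp α δ (r, m + 1) + δ = mlExp α δ (r + 1, m + 1) := by
      simp only [mlExp]; push_cast; ring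
    have e2 : mlExp α δ (r + 1, m) + α = mlExp α δ (r + 1, m + 1) := by
      simp only [mlExp]; push_cast; ring
    have hc : ((r + 1 + (m + 1)).choose (m + 1) : ℂ) =
        ((r + 1 + m).choose m : ℂ) + ((r + (m + 1)).choose (m + 1) : ℂ) := by
      rw [show r + 1 + (m + 1) = (r + 1 + m) + 1 by ring, Nat.choose_succ_succ]
      push_cast
      rw [show r + 1 + m = r + (m + 1) by ring]
    simp [T₁, T₂, e1, e2]
    simp only [mlCoeff, hc]
    ring

/-- `exists_mlTerm_bound` for a single `b`, without the growth estimate. -/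
theorem exists_mlTerm_bound' {α δ lam σ T : ℝ} (hα : 0 < α) (hδ : 0 ≤ δ)
    (hlam : δ = 0 → |lam| < 1) (hσ : 0 < σ) (hT : 0 < T) (b : ℂ) :
    ∃ d : ℕ × ℕ → ℝ, (∀ p, 0 ≤ d p) ∧ Summable d ∧
      ∀ t : ℝ, 0 < t → t ≤ T → ∀ p, ‖mlTerm α δ lam b σ t p‖ ≤ t ^ (σ - 1) * d p := by
  obtain ⟨C, c, -, -, h⟩ := exists_mlTerm_bound (lam := lam) hα hδ hlam hσ hT
  obtain ⟨d, hd0, hd, -, h⟩ := h ‖b‖ (norm_nonneg b)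
  exact ⟨d, hd0, hd, h b le_rfl⟩

theorem measurable_mlTerm (α δ lam : ℝ) (b : ℂ) (σ : ℝ) (p : ℕ × ℕ) :
    Measurable fun t => mlTerm α δ lam b σ t p :=
  (Complex.measurable_ofReal.comp (measurable_rlKernel _)).const_mul _

theorem rpow_le_rpow_of_one_le {σ t T : ℝ} (hσ : 1 ≤ σ) (ht : 0 ≤ t) (htT : t ≤ T) :
    t ^ (σ - 1) ≤ T ^ (σ - 1) :=
  Real.rpow_le_rpow ht htT (by linarith)

section
variable {α δ lam : ℝ} (hα : 0 < α) (hδ : 0 ≤ δ) (hlam : δ = 0 → |lam| < 1) (b : ℂ)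
include hα hδ hlam

theorem hasSum_mlConv {σ T : ℝ} (hσ : 1 ≤ σ) (hT : 0 < T) {u : ℝ → ℂ}
    (hu : IntegrableOn u (Set.Ioc 0 T)) :
    HasSum (fun p => mlCoeff lam b p * rlIntegral (mlExp α δ p + σ) u T)
      (∫ s in (0 : ℝ)..T, mlKernel α δ lam b σ (T - s) * u s) := by
  have hσ0 : 0 < σ := by linarith
  obtain ⟨d, hd0, hd, hb⟩ := exists_mlTerm_bound' hα hδ hlam hσ0 hT b
  have hne : ∀ᵐ s : ℝ, s ≠ T := compl_mem_ae_iff.2 (measure_singleton T)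
  have hterm : ∀ p, ∫ s in (0 : ℝ)..T, mlTerm α δ lam b σ (T - s) p * u s =
      mlCoeff lam b p * rlIntegral (mlExp α δ p + σ) u T := by
    intro p
    have := mlExp_nonneg hα.le hδ p
    rw [rlIntegral_eq (by linarith), ← intervalIntegral.integral_const_mul]
    simp only [mlTerm, mul_assoc]
  simp only [← hterm]
  refine intervalIntegral.hasSum_integral_of_dominated_convergence
    (fun p s => T ^ (σ - 1) * d p * ‖u s‖) ?_ ?_ ?_ ?_ ?_
  · intro p
    rw [Set.uIoc_of_le hT.le]
    exact ((measurable_mlTerm α δ lam b σ p).comp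
      (measurable_const.sub measurable_id)).aestronglyMeasurable.mul hu.1
  · intro p
    filter_upwards [hne] with s hs hsT
    rw [Set.uIoc_of_le hT.le] at hsT
    have h1 : 0 < T - s := sub_pos.2 (lt_of_le_of_ne hsT.2 hs)
    rw [norm_mul]
    gcongr
    exact (hb (T - s) h1 (by linarith [hsT.1]) p).trans (mul_le_mul_of_nonneg_right
      (rpow_le_rpow_of_one_le hσ h1.le (by linarith [hsT.1])) (hd0 p))
  · exact ae_of_all _ fun s _ => (hd.mul_left _).mul_right _
  · rw [intervalIntegrable_iff_integrableOn_Ioc_of_le hT.le]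
    simp only [tsum_mul_right]
    exact hu.norm.const_mul _
  · filter_upwards [hne] with s hs hsT
    rw [Set.uIoc_of_le hT.le] at hsT
    exact (summable_mlTerm hα hδ hlam hσ0
      (sub_pos.2 (lt_of_le_of_ne hsT.2 hs)) b).hasSum.mul_right _

theorem norm_mlKernel_le {σ T : ℝ} (hσ : 0 < σ) (hT : 0 < T) :
    ∃ M : ℝ, 0 ≤ M ∧ ∀ t : ℝ, 0 < t → t ≤ T → ‖mlKernel α δ lam b σ t‖ ≤ t ^ (σ - 1) * M := by
  obtain ⟨d, hd0, hd, hb⟩ := exists_mlTerm_bound' hα hδ hlam hσ hT b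
  refine ⟨∑' p, d p, tsum_nonneg hd0, fun t ht htT => ?_⟩
  rw [← tsum_mul_left]
  exact tsum_of_norm_bounded (hd.mul_left _).hasSum (hb t ht htT)

theorem continuousOn_mlKernel {σ : ℝ} (hσ : 0 < σ) :
    ContinuousOn (mlKernel α δ lam b σ) (Set.Ioi 0) := by
  intro t₀ ht₀
  have ht₀' : (0 : ℝ) < t₀ := ht₀
  obtain ⟨d, hd0, hd, hb⟩ := exists_mlTerm_bound' hα hδ hlam hσ
    (by linarith : 0 < 2 * t₀) b
  -- Without the factor `t ^ (σ - 1)` the series converges uniformly up to `t = 0`.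
  have h1 : ContinuousOn (fun t => ∑' p, ((t ^ (1 - σ) : ℝ) : ℂ) * mlTerm α δ lam b σ t p)
      (Set.Ioo 0 (2 * t₀)) := by
    refine continuousOn_tsum (fun p => ?_) hd (fun p t ht => ?_)
    · intro t ht
      have hne : t ≠ 0 := ht.1.ne'
      refine ContinuousAt.continuousWithinAt ?_
      refine ContinuousAt.mul ?_ ?_
      · exact Complex.continuous_ofReal.continuousAt.comp
          (Real.continuousAt_rpow_const _ _ (Or.inl hne))
      · refine continuousAt_const.mul (Complex.continuous_ofReal.continuousAt.comp ?_)
        exact (Real.continuousAt_rpow_const _ _ (Or.inl hne)).div_const _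
    · rw [norm_mul, Complex.norm_real, Real.norm_of_nonneg (by have := ht.1; positivity)]
      calc _ ≤ t ^ (1 - σ) * (t ^ (σ - 1) * d p) := by
            have := ht.1
            gcongr
            exact hb t ht.1 ht.2.le p
        _ = d p := by
            rw [← mul_assoc, ← Real.rpow_add ht.1]
            simp
  have h2 : ContinuousAt (fun t => ((t ^ (σ - 1) : ℝ) : ℂ) *
      ∑' p, ((t ^ (1 - σ) : ℝ) : ℂ) * mlTerm α δ lam b σ t p) t₀ := by
    refine ContinuousAt.mul ?_ (h1.continuousAt (Ioo_mem_nhds ht₀' (by linarith)))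
    exact Complex.continuous_ofReal.continuousAt.comp
          (Real.continuousAt_rpow_const _ _ (Or.inl ht₀'.ne'))
  refine (h2.congr ?_).continuousWithinAt
  filter_upwards [Ioi_mem_nhds ht₀'] with t ht
  rw [tsum_mul_left, ← mul_assoc, ← Complex.ofReal_mul, ← Real.rpow_add ht]
  simp [mlKernel]

theorem intervalIntegrable_mlKernel {σ T : ℝ} (hσ : 0 < σ) (hT : 0 < T) :
    IntervalIntegrable (mlKernel α δ lam b σ) volume 0 T := by
  obtain ⟨M, hM, h⟩ := norm_mlKernel_le hα hδ hlam b hσ hT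
  have h1 : IntervalIntegrable (fun t : ℝ => t ^ (σ - 1) * M) volume 0 T :=
    (intervalIntegral.intervalIntegrable_rpow' (by linarith)).mul_const M
  rw [intervalIntegrable_iff_integrableOn_Ioc_of_le hT.le] at h1 ⊢
  refine Integrable.mono' h1 ?_ ?_
  · exact ((continuousOn_mlKernel hα hδ hlam b hσ).mono
      Set.Ioc_subset_Ioi_self).aestronglyMeasurable measurableSet_Ioc
  · filter_upwards [ae_restrict_mem measurableSet_Ioc] with t ht
    exact h t ht.1 ht.2

theorem integral_mlKernel {σ T : ℝ} (hσ : 0 < σ) (hT : 0 < T) :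
    ∫ t in (0 : ℝ)..T, mlKernel α δ lam b σ t = mlKernel α δ lam b (σ + 1) T := by
  obtain ⟨d, hd0, hd, hb⟩ := exists_mlTerm_bound' hα hδ hlam hσ hT b
  have hterm : ∀ p, ∫ t in (0 : ℝ)..T, mlTerm α δ lam b σ t p =
      mlTerm α δ lam b (σ + 1) T p := by
    intro p
    have he := mlExp_nonneg hα.le hδ p
    have h1 := integral_rlKernel_mul one_pos (by linarith : 0 < mlExp α δ p + σ) hT
    simp only [rlKernel_one, one_mul] at h1
    simp only [mlTerm]
    rw [intervalIntegral.integral_const_mul, intervalIntegral.integral_ofReal, h1]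
    congr 3
    ring
  have h : HasSum (fun p => ∫ t in (0 : ℝ)..T, mlTerm α δ lam b σ t p)
      (∫ t in (0 : ℝ)..T, mlKernel α δ lam b σ t) := by
    refine intervalIntegral.hasSum_integral_of_dominated_convergence
      (fun p t => t ^ (σ - 1) * d p) ?_ ?_ ?_ ?_ ?_
    · exact fun p => (measurable_mlTerm α δ lam b σ p).aestronglyMeasurable
    · refine fun p => ae_of_all _ fun t ht => ?_
      rw [Set.uIoc_of_le hT.le] at ht
      exact hb t ht.1 ht.2 p
    · exact ae_of_all _ fun t _ => hd.mul_left _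
    · simp only [tsum_mul_left]
      exact (intervalIntegral.intervalIntegrable_rpow' (by linarith)).mul_const _
    · refine ae_of_all _ fun t ht => ?_
      rw [Set.uIoc_of_le hT.le] at ht
      exact (summable_mlTerm hα hδ hlam hσ ht.1 b).hasSum
  simp only [hterm] at h
  exact h.unique (summable_mlTerm hα hδ hlam (by linarith) hT b).hasSum

/-- Convolution with `mlKernel`, of order above one, gives a continuous function. -/
theorem continuousOn_mlConv {σ : ℝ} (hσ : 1 < σ) {u : ℝ → ℂ}
    (hu : ∀ T : ℝ, 0 < T → IntegrableOn u (Set.Ioc 0 T)) :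
    ContinuousOn (fun t => ∫ s in (0 : ℝ)..t, mlKernel α δ lam b σ (t - s) * u s) (Set.Ioi 0) := by
  intro t₀ ht₀
  have ht₀' : (0 : ℝ) < t₀ := ht₀
  have hA : 0 < 2 * t₀ := by linarith
  set A := 2 * t₀ with hAdef
  obtain ⟨d, hd0, hd, hb⟩ := exists_mlTerm_bound' hα hδ hlam (by linarith : 0 < σ) hA b
  have hzero : ∀ p, mlTerm α δ lam b σ 0 p = 0 := by
    intro p
    have := mlExp_nonneg hα.le hδ p
    simp [mlTerm, rlKernel, Real.zero_rpow (by linarith : mlExp α δ p + σ - 1 ≠ 0)]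
  have hbd : ∀ v ≤ A, ∀ p, ‖mlTerm α δ lam b σ (max v 0) p‖ ≤ A ^ (σ - 1) * d p := by
    intro v hv p
    have := hd0 p
    rcases le_or_gt v 0 with h | h
    · rw [max_eq_right h, hzero, norm_zero]
      positivity
    · rw [max_eq_left h.le]
      exact (hb v h hv p).trans (mul_le_mul_of_nonneg_right
        (rpow_le_rpow_of_one_le hσ.le h.le hv) (hd0 p))
  -- Extended by zero to the left, the kernel is continuous.
  let K : ℝ → ℂ := fun v => mlKernel α δ lam b σ (max v 0)
  have hK0 : ∀ v ≤ 0, K v = 0 := by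
    intro v hv
    simp [K, mlKernel, max_eq_right hv, hzero]
  have hKc : ContinuousOn K (Set.Iic A) := by
    refine continuousOn_tsum (u := fun p => A ^ (σ - 1) * d p) (fun p => ?_) (hd.mul_left _)
      (fun p v hv => hbd v hv p)
    have := mlExp_nonneg hα.le hδ p
    refine Continuous.continuousOn (continuous_const.mul (Complex.continuous_ofReal.comp ?_))
    exact ((continuous_id.max continuous_const).rpow_const
      (fun _ => Or.inr (by linarith))).div_const _
  have hKb : ∀ v ≤ A, ‖K v‖ ≤ ∑' p, A ^ (σ - 1) * d p := fun v hv =>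
    tsum_of_norm_bounded (hd.mul_left _).hasSum (hbd v hv)
  have hmeas : ∀ t ≤ A, AEStronglyMeasurable (fun s => K (t - s) * u s)
      (volume.restrict (Set.Ioc 0 A)) := by
    intro t ht
    refine AEStronglyMeasurable.mul ?_ (hu A hA).1
    refine ContinuousOn.aestronglyMeasurable (hKc.comp (by fun_prop) ?_) measurableSet_Ioc
    intro s hs
    have := hs.1
    simp only [Set.mem_Iic]
    linarith
  have hcont : ContinuousAt (fun t => ∫ s in Set.Ioc 0 A, K (t - s) * u s) t₀ := by
    refine continuousAt_of_dominated (bound := fun s => (∑' p, A ^ (σ - 1) * d p) * ‖u s‖)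
      ?_ ?_ ((hu A hA).norm.const_mul _) ?_
    · filter_upwards [Iio_mem_nhds (by linarith : t₀ < A)] with t ht
      exact hmeas t (le_of_lt ht)
    · filter_upwards [Iio_mem_nhds (by linarith : t₀ < A)] with t ht
      filter_upwards [ae_restrict_mem measurableSet_Ioc] with s hs
      rw [norm_mul]
      gcongr
      exact hKb _ (by have := hs.1; have : t < A := ht; linarith)
    · filter_upwards [ae_restrict_mem measurableSet_Ioc] with s hs
      refine ContinuousAt.mul ?_ continuousAt_const
      have hs1 := hs.1
      have h1 : ContinuousAt K (t₀ - s) := hKc.continuousAt (Iic_mem_nhds (by linarith))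
      exact ContinuousAt.comp (f := fun t => t - s) h1 (by fun_prop)
  refine (hcont.congr ?_).continuousWithinAt
  filter_upwards [Ioo_mem_nhds ht₀' (by linarith : t₀ < A)] with t ht
  rw [intervalIntegral.integral_of_le ht.1.le, ← Set.Ioc_union_Ioc_eq_Ioc ht.1.le ht.2.le]
  have hint : IntegrableOn (fun s => K (t - s) * u s) (Set.Ioc 0 A) := by
    refine Integrable.mono' ((hu A hA).norm.const_mul (∑' p, A ^ (σ - 1) * d p))
      (hmeas t ht.2.le) ?_
    filter_upwards [ae_restrict_mem measurableSet_Ioc] with s hs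
    rw [norm_mul]
    gcongr
    exact hKb _ (by have := hs.1; have := ht.2; linarith)
  have hright : ∫ s in Set.Ioc t A, K (t - s) * u s = 0 :=
    setIntegral_eq_zero_of_forall_eq_zero fun s hs => by rw [hK0 _ (by linarith [hs.1]), zero_mul]
  rw [setIntegral_union (Set.Ioc_disjoint_Ioc_of_le le_rfl) measurableSet_Ioc
    (hint.mono_set (Set.Ioc_subset_Ioc_right ht.2.le))
    (hint.mono_set (Set.Ioc_subset_Ioc_left ht.1.le)), hright, add_zero]
  refine setIntegral_congr_fun measurableSet_Ioc fun s hs => ?_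
  simp only [K]
  rw [max_eq_left (by linarith [hs.2])]

theorem norm_mlConv_le {σ T : ℝ} (hσ : 1 < σ) (hT : 0 < T) {u : ℝ → ℂ}
    (hu : IntegrableOn u (Set.Ioc 0 T)) :
    ∃ d : ℕ × ℕ → ℝ, Summable d ∧ ∀ t : ℝ, 0 < t → t ≤ T → ∀ p,
      ‖mlCoeff lam b p * rlIntegral (mlExp α δ p + σ) u t‖ ≤ d p := by
  obtain ⟨d, hd0, hd, hb⟩ := exists_mlTerm_bound' hα hδ hlam (by linarith : 0 < σ) hT b
  refine ⟨fun p => (T ^ (σ - 1) * ∫ s in Set.Ioc 0 T, ‖u s‖) * d p, hd.mul_left _,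
    fun t ht htT p => ?_⟩
  have he := mlExp_nonneg hα.le hδ p
  have hd0p := hd0 p
  have hui := (hu.mono_set (Set.Ioc_subset_Ioc_right htT)).norm
  rw [rlIntegral_eq (by linarith), ← intervalIntegral.integral_const_mul]
  have h1 : ‖∫ s in (0 : ℝ)..t, mlCoeff lam b p *
      ((rlKernel (mlExp α δ p + σ) (t - s) : ℂ) * u s)‖ ≤
      ∫ s in (0 : ℝ)..t, T ^ (σ - 1) * d p * ‖u s‖ := by
    refine intervalIntegral.norm_integral_le_of_norm_le ht.le ?_ ?_
    · have hne : ∀ᵐ s : ℝ, s ≠ t := compl_mem_ae_iff.2 (measure_singleton t)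
      filter_upwards [hne] with s hs hst
      have h1 : 0 < t - s := sub_pos.2 (lt_of_le_of_ne hst.2 hs)
      rw [← mul_assoc, norm_mul]
      gcongr
      exact (hb (t - s) h1 (by linarith [hst.1]) p).trans (mul_le_mul_of_nonneg_right
        (rpow_le_rpow_of_one_le hσ.le h1.le (by linarith [hst.1])) (hd0 p))
    · rw [intervalIntegrable_iff_integrableOn_Ioc_of_le ht.le]
      exact hui.const_mul _
  refine h1.trans ?_
  rw [intervalIntegral.integral_const_mul, intervalIntegral.integral_of_le ht.le]
  rw [mul_right_comm]
  refine mul_le_mul_of_nonneg_right (mul_le_mul_of_nonneg_left ?_ (by positivity)) hd0p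
  exact setIntegral_mono_set hu.norm (ae_of_all _ fun s => norm_nonneg _)
    (Set.Ioc_subset_Ioc_right htT).eventuallyLE

end

/-! ### The equation of a Fourier mode -/

theorem rlIntegral_sub_const_mul {σ T : ℝ} (hσ : 1 ≤ σ) (hT : 0 < T) {u v : ℝ → ℂ}
    (hu : IntegrableOn u (Set.Ioc 0 T)) (hv : IntegrableOn v (Set.Ioc 0 T)) (b : ℂ) :
    rlIntegral σ (fun s => u s - b * v s) T = rlIntegral σ u T - b * rlIntegral σ v T := by
  have hσ0 : σ ≠ 0 := by linarith
  rw [rlIntegral_eq hσ0, rlIntegral_eq hσ0, rlIntegral_eq hσ0,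
    ← intervalIntegral.integral_const_mul, ← intervalIntegral.integral_sub
      (intervalIntegrable_rlKernel_mul hσ hT hu)
      ((intervalIntegrable_rlKernel_mul hσ hT hv).const_mul b)]
  congr 1
  funext s
  ring

/-- The equation for one Fourier mode, integrated twice in time:
`₀I^{2-α} n + λ ₀I^{2-β} n = g + t f + ₀I² (φ - b n)`. -/
def IsMode (α β lam : ℝ) (b f g : ℂ) (φ n : ℝ → ℂ) : Prop :=
  ∀ T : ℝ, 0 < T → rlIntegral (2 - α) n T + (lam : ℂ) * rlIntegral (2 - β) n T =
    g + (T : ℂ) * f + rlIntegral 2 (fun s => φ s - b * n s) T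

section
variable {α β lam : ℝ} (hα : 1 < α) (hα2 : α ≤ 2) (hβα : β ≤ α)
  (hlam : β = α → |lam| < 1) {b f g : ℂ} {φ n : ℝ → ℂ}
  (hn : ∀ T : ℝ, 0 < T → IntegrableOn n (Set.Ioc 0 T))
  (hφ : ∀ T : ℝ, 0 < T → IntegrableOn φ (Set.Ioc 0 T))
  (hmode : IsMode α β lam b f g φ n)
include hα hα2 hβα hn hφ hmode

/-- Applying `₀I^{e+α-1}` leaves only integrals of order at least one. -/
theorem IsMode.rlIntegral_eq {e T : ℝ} (he : 0 ≤ e) (hT : 0 < T) :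
    rlIntegral (e + 1) n T + lam * rlIntegral (e + (α - β) + 1) n T +
        b * rlIntegral (e + α + 1) n T =
      g * (rlKernel (e + α) T : ℂ) + f * (rlKernel (e + (α + 1)) T : ℂ) +
        rlIntegral (e + (α + 1)) φ T := by
  have hP : 0 < e + α - 1 := by linarith
  have hu : IntegrableOn (fun s => φ s - b * n s) (Set.Ioc 0 T) :=
    (hφ T hT).sub ((hn T hT).const_mul b)
  have i1 := intervalIntegrable_rlKernel_mul_rlIntegral hP (by linarith : 0 ≤ 2 - α)
    (by linarith) hT (hn T hT)
  have i2 := (intervalIntegrable_rlKernel_mul_rlIntegral hP (by linarith : 0 ≤ 2 - β)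
    (by linarith) hT (hn T hT)).const_mul (lam : ℂ)
  have i3 := intervalIntegrable_rlKernel_mul_rlIntegral hP (by norm_num : (0 : ℝ) ≤ 2)
    (by linarith) hT hu
  have k1 := integral_rlKernel_mul hP one_pos hT
  have k2 := integral_rlKernel_mul hP two_pos hT
  have j : ∀ q : ℝ, 0 < q →
      IntervalIntegrable (fun t => ((rlKernel (e + α - 1) (T - t) * rlKernel q t : ℝ) : ℂ))
        volume 0 T := by
    intro q hq
    have h := intervalIntegrable_rlKernel_mul_shift hP hq hT
    simp only [sub_zero] at h
    exact ⟨h.1.ofReal, h.2.ofReal⟩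
  have i4 : IntervalIntegrable
      (fun t => g * ((rlKernel (e + α - 1) (T - t) * rlKernel 1 t : ℝ) : ℂ)) volume 0 T :=
    (j 1 one_pos).const_mul g
  have i5 : IntervalIntegrable
      (fun t => f * ((rlKernel (e + α - 1) (T - t) * rlKernel 2 t : ℝ) : ℂ)) volume 0 T :=
    (j 2 two_pos).const_mul f
  have key : ∫ t in (0 : ℝ)..T, ((rlKernel (e + α - 1) (T - t) : ℂ) * rlIntegral (2 - α) n t +
      lam * ((rlKernel (e + α - 1) (T - t) : ℂ) * rlIntegral (2 - β) n t)) =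
      ∫ t in (0 : ℝ)..T, (g * ((rlKernel (e + α - 1) (T - t) * rlKernel 1 t : ℝ) : ℂ) +
        f * ((rlKernel (e + α - 1) (T - t) * rlKernel 2 t : ℝ) : ℂ) +
        (rlKernel (e + α - 1) (T - t) : ℂ) * rlIntegral 2 (fun s => φ s - b * n s) t) := by
    rw [intervalIntegral.integral_of_le hT.le, intervalIntegral.integral_of_le hT.le]
    refine setIntegral_congr_fun measurableSet_Ioc fun t ht => ?_
    have h := hmode t ht.1
    simp only [rlKernel_one, rlKernel_two]
    push_cast
    linear_combination (rlKernel (e + α - 1) (T - t) : ℂ) * h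
  rw [intervalIntegral.integral_add i1 i2, intervalIntegral.integral_add (i4.add i5) i3,
    intervalIntegral.integral_add i4 i5, intervalIntegral.integral_const_mul,
    intervalIntegral.integral_const_mul, intervalIntegral.integral_const_mul,
    intervalIntegral.integral_ofReal, intervalIntegral.integral_ofReal, k1, k2,
    rlIntegral_rlIntegral hP (by linarith) (by linarith) hT (hn T hT),
    rlIntegral_rlIntegral hP (by linarith) (by linarith) hT (hn T hT),
    rlIntegral_rlIntegral hP (by linarith) (by linarith) hT hu,
    rlIntegral_sub_const_mul (by linarith) hT (hφ T hT) (hn T hT)] at key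
  rw [show e + α - 1 + (2 - α) = e + 1 by ring, show e + α - 1 + (2 - β) = e + (α - β) + 1 by ring,
    show e + α - 1 + 1 = e + α by ring, show e + α - 1 + 2 = e + (α + 1) by ring] at key
  rw [show e + α + 1 = e + (α + 1) by ring]
  linear_combination key

include hlam

/-- The mode equation summed against the coefficients of the double series. Its two sides are
primitives of the two sides of `IsMode.eq_mlKernel`. -/
theorem IsMode.integral_eq {T : ℝ} (hT : 0 < T) :
    IntervalIntegrable (fun t =>
      g * mlKernel α (α - β) lam b (α - 1) t + f * mlKernel α (α - β) lam b α t +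
        ∫ s in (0 : ℝ)..t, mlKernel α (α - β) lam b α (t - s) * φ s) volume 0 T ∧
    ∫ t in (0 : ℝ)..T, n t = ∫ t in (0 : ℝ)..T,
      (g * mlKernel α (α - β) lam b (α - 1) t + f * mlKernel α (α - β) lam b α t +
        ∫ s in (0 : ℝ)..t, mlKernel α (α - β) lam b α (t - s) * φ s) := by
  have hα0 : 0 < α := by linarith
  have hδ : 0 ≤ α - β := by linarith
  have hlam' : α - β = 0 → |lam| < 1 := fun h => hlam (by linarith)
  have s0 := hasSum_mlConv hα0 hδ hlam' b le_rfl hT (hn T hT)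
  have s1 := hasSum_mlConv hα0 hδ hlam' b (by linarith : 1 ≤ (α - β) + 1) hT (hn T hT)
  have s2 := hasSum_mlConv hα0 hδ hlam' b (by linarith : 1 ≤ α + 1) hT (hn T hT)
  simp only [← add_assoc] at s1 s2
  have hp := pascal_sum (A := fun x => rlIntegral (x + 1) n T) s0 s1 s2
  have r1 := (summable_mlTerm hα0 hδ hlam' hα0 hT b).hasSum.mul_left g
  have r2 := (summable_mlTerm hα0 hδ hlam' (by linarith : 0 < α + 1) hT b).hasSum.mul_left f
  have hconv := fun t (ht : 0 < t) => hasSum_mlConv hα0 hδ hlam' b hα.le ht (hφ t ht)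
  obtain ⟨d, hd, hb⟩ := norm_mlConv_le hα0 hδ hlam' b hα hT (hφ T hT)
  have hone : ∀ σ : ℝ, 0 ≤ σ → IntervalIntegrable (fun t => rlIntegral σ φ t) volume 0 T ∧
      ∫ t in (0 : ℝ)..T, rlIntegral σ φ t = rlIntegral (1 + σ) φ T := by
    intro σ hσ
    have h1 := intervalIntegrable_rlKernel_mul_rlIntegral one_pos hσ (by linarith) hT (hφ T hT)
    have h2 := rlIntegral_rlIntegral one_pos hσ (by linarith) hT (hφ T hT)
    simp only [rlKernel_one, Complex.ofReal_one, one_mul] at h1 h2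
    exact ⟨h1, h2⟩
  have r3 : HasSum (fun p => mlCoeff lam b p * rlIntegral (mlExp α (α - β) p + (α + 1)) φ T)
      (∫ t in (0 : ℝ)..T, ∫ s in (0 : ℝ)..t, mlKernel α (α - β) lam b α (t - s) * φ s) := by
    have hterm : ∀ p, ∫ t in (0 : ℝ)..T, mlCoeff lam b p *
        rlIntegral (mlExp α (α - β) p + α) φ t =
        mlCoeff lam b p * rlIntegral (mlExp α (α - β) p + (α + 1)) φ T := by
      intro p
      have := mlExp_nonneg hα0.le hδ p
      rw [intervalIntegral.integral_const_mul, (hone _ (by linarith)).2]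
      congr 2
      ring
    simp only [← hterm]
    refine intervalIntegral.hasSum_integral_of_dominated_convergence (fun p _ => d p)
      ?_ ?_ ?_ ?_ ?_
    · intro p
      have := mlExp_nonneg hα0.le hδ p
      rw [Set.uIoc_of_le hT.le]
      exact ((hone _ (by linarith)).1.const_mul _).1.aestronglyMeasurable
    · refine fun p => ae_of_all _ fun t ht => ?_
      rw [Set.uIoc_of_le hT.le] at ht
      exact hb t ht.1 ht.2 p
    · exact ae_of_all _ fun t _ => hd
    · exact intervalIntegrable_const
    · refine ae_of_all _ fun t ht => ?_
      rw [Set.uIoc_of_le hT.le] at ht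
      exact hconv t ht.1
  have hiφ : IntervalIntegrable
      (fun t => ∫ s in (0 : ℝ)..t, mlKernel α (α - β) lam b α (t - s) * φ s) volume 0 T := by
    rw [intervalIntegrable_iff_integrableOn_Ioc_of_le hT.le]
    refine Integrable.mono' (integrable_const (∑' p, d p)) ?_ ?_
    · exact ((continuousOn_mlConv hα0 hδ hlam' b hα hφ).mono
        Set.Ioc_subset_Ioi_self).aestronglyMeasurable measurableSet_Ioc
    · filter_upwards [ae_restrict_mem measurableSet_Ioc] with t ht
      rw [← (hconv t ht.1).tsum_eq]
      exact tsum_of_norm_bounded hd.hasSum (hb t ht.1 ht.2)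
  have hl := ((s0.add (s1.mul_left (lam : ℂ))).add (s2.mul_left b)).unique
    (((r1.add r2).add r3).congr_fun fun p => by
      have h := hmode.rlIntegral_eq hα hα2 hβα hn hφ (mlExp_nonneg hα0.le hδ p) hT
      simp only [mlTerm]
      linear_combination mlCoeff lam b p * h)
  have i1 := (intervalIntegrable_mlKernel hα0 hδ hlam' b (by linarith : 0 < α - 1) hT).const_mul g
  have i2 := (intervalIntegrable_mlKernel hα0 hδ hlam' b hα0 hT).const_mul f
  refine ⟨(i1.add i2).add hiφ, ?_⟩
  rw [intervalIntegral.integral_add (i1.add i2) hiφ, intervalIntegral.integral_add i1 i2,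
    intervalIntegral.integral_const_mul, intervalIntegral.integral_const_mul,
    integral_mlKernel hα0 hδ hlam' b (by linarith : 0 < α - 1) hT,
    integral_mlKernel hα0 hδ hlam' b hα0 hT, sub_add_cancel]
  have hone' : rlIntegral (0 + 1) n T = ∫ t in (0 : ℝ)..T, n t := by
    rw [zero_add, FracRD.rlIntegral_eq one_ne_zero]
    simp [rlKernel_one]
  rw [← hone', ← hp, hl]
  rfl

/-- The solution of the mode equation. -/
theorem IsMode.eq_mlKernel (hnc : ContinuousOn n (Set.Ioi 0)) {t : ℝ} (ht : 0 < t) :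
    n t = g * mlKernel α (α - β) lam b (α - 1) t + f * mlKernel α (α - β) lam b α t +
        ∫ s in (0 : ℝ)..t, mlKernel α (α - β) lam b α (t - s) * φ s := by
  have hα0 : 0 < α := by linarith
  have hδ : 0 ≤ α - β := by linarith
  have hlam' : α - β = 0 → |lam| < 1 := fun h => hlam (by linarith)
  set W : ℝ → ℂ := fun t =>
    g * mlKernel α (α - β) lam b (α - 1) t + f * mlKernel α (α - β) lam b α t +
        ∫ s in (0 : ℝ)..t, mlKernel α (α - β) lam b α (t - s) * φ s with hW
  have hWc : ContinuousOn W (Set.Ioi 0) :=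
    (((continuousOn_mlKernel hα0 hδ hlam' b (by linarith)).const_mul g).add
      ((continuousOn_mlKernel hα0 hδ hlam' b hα0).const_mul f)).add
      (continuousOn_mlConv hα0 hδ hlam' b hα hφ)
  have hd : ∀ v : ℝ → ℂ, ContinuousOn v (Set.Ioi 0) →
      HasDerivAt (fun T => ∫ s in t..T, v s) (v t) t := fun v hv =>
    intervalIntegral.integral_hasDerivAt_right (by simp)
      (hv.stronglyMeasurableAtFilter isOpen_Ioi t ht) (hv.continuousAt (Ioi_mem_nhds ht))
  refine (hd n hnc).unique ((hd W hWc).congr_of_eventuallyEq ?_)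
  filter_upwards [Ioi_mem_nhds ht] with T hT
  have hni : ∀ S, 0 < S → IntervalIntegrable n volume 0 S := fun S hS =>
    (intervalIntegrable_iff_integrableOn_Ioc_of_le hS.le).2 (hn S hS)
  obtain ⟨hWT, hT'⟩ := hmode.integral_eq hα hα2 hβα hlam hn hφ hT
  obtain ⟨hWt, ht'⟩ := hmode.integral_eq hα hα2 hβα hlam hn hφ ht
  rw [← intervalIntegral.integral_interval_sub_left (hni T hT) (hni t ht),
    ← intervalIntegral.integral_interval_sub_left hWT hWt, hT', ht']

end

/-! ### Solutions in Fourier space -/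

theorem rlDeriv_sub_two {α : ℝ} (hα2 : α ≤ 2) (u : ℝ → ℂ) :
    rlDeriv (α - 2) u = rlIntegral (2 - α) u := by
  funext t
  rw [rlDeriv, Nat.ceil_eq_zero.2 (by linarith)]
  simp

theorem rlDeriv_sub_one {α : ℝ} (hα : 1 < α) (hα2 : α ≤ 2) (u : ℝ → ℂ) :
    rlDeriv (α - 1) u = deriv (rlIntegral (2 - α) u) := by
  funext t
  have h : ⌈α - 1⌉₊ = 1 := by
    rw [Nat.ceil_eq_iff one_ne_zero]; constructor <;> norm_num <;> linarith
  rw [rlDeriv, h, iteratedDeriv_one]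
  norm_num
  rw [show 1 - (α - 1) = 2 - α by ring]

theorem rlDeriv_eq_deriv_deriv {α : ℝ} (hα : 1 < α) (hα2 : α ≤ 2) (u : ℝ → ℂ) :
    rlDeriv α u = deriv (deriv (rlIntegral (2 - α) u)) := by
  funext t
  have h : ⌈α⌉₊ = 2 := by
    rw [Nat.ceil_eq_iff two_ne_zero]; constructor <;> norm_num <;> linarith
  rw [rlDeriv, h, iteratedDeriv_succ, iteratedDeriv_one]
  norm_num

/-- Taylor's formula at `0`, with integral remainder, from one-sided limits at `0`. -/
theorem taylor_two {F ρ : ℝ → ℂ} {f g : ℂ} {T : ℝ} (hT : 0 < T)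
    (hF : ∀ t, 0 < t → DifferentiableAt ℝ F t) (hF' : ∀ t, 0 < t → HasDerivAt (deriv F) (ρ t) t)
    (hρ : IntegrableOn ρ (Set.Ioc 0 T)) (hg : Tendsto F (𝓝[>] 0) (𝓝 g))
    (hf : Tendsto (deriv F) (𝓝[>] 0) (𝓝 f)) :
    F T = g + (T : ℂ) * f + ∫ s in (0 : ℝ)..T, ((T - s : ℝ) : ℂ) * ρ s := by
  -- Integration by parts: `(T - s) F' + F` is a primitive of `(T - s) ρ`.
  have hd : ∀ s ∈ Set.Ioo 0 T, HasDerivAt (fun s => ((T - s : ℝ) : ℂ) * deriv F s + F s)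
      (((T - s : ℝ) : ℂ) * ρ s) s := by
    intro s hs
    have h1 : HasDerivAt (fun s : ℝ => ((T - s : ℝ) : ℂ)) ((-1 : ℝ) : ℂ) s :=
      ((hasDerivAt_id s).const_sub T).ofReal_comp
    refine ((h1.mul (hF' s hs.1)).add (hF s hs.1).hasDerivAt).congr_deriv ?_
    push_cast
    ring
  have hi : IntervalIntegrable (fun s => ((T - s : ℝ) : ℂ) * ρ s) volume 0 T :=
    IntervalIntegrable.continuousOn_mul
      ((intervalIntegrable_iff_integrableOn_Ioc_of_le hT.le).2 hρ)
      (by fun_prop)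
  have c1 : ∀ l : Filter ℝ, ∀ a : ℝ, Tendsto id l (𝓝 a) →
      Tendsto (fun s : ℝ => ((T - s : ℝ) : ℂ)) l (𝓝 ((T - a : ℝ) : ℂ)) := fun l a h =>
    (Complex.continuous_ofReal.tendsto _).comp (tendsto_const_nhds.sub h)
  have h0 := ((c1 (𝓝[>] 0) 0 nhdsWithin_le_nhds).mul hf).add hg
  have hcF : Tendsto F (𝓝[<] T) (𝓝 (F T)) := (hF T hT).continuousAt.tendsto.mono_left
    nhdsWithin_le_nhds
  have hcF' : Tendsto (deriv F) (𝓝[<] T) (𝓝 (deriv F T)) :=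
    (hF' T hT).continuousAt.tendsto.mono_left nhdsWithin_le_nhds
  have h1 := ((c1 (𝓝[<] T) T nhdsWithin_le_nhds).mul hcF').add hcF
  rw [intervalIntegral.integral_eq_sub_of_hasDerivAt_of_tendsto hT hd hi h0 h1]
  simp only [sub_self, sub_zero, Complex.ofReal_zero, zero_mul, zero_add]
  ring

/-- The jump of `sign` at `0` is compensated by the factor `|k| ^ γ`. -/
theorem continuous_rfSymbol {γ θ : ℝ} (hγ : 0 < γ) : Continuous (rfSymbol γ θ) := by
  rw [continuous_iff_continuousAt]
  intro k
  have habs : Continuous fun k : ℝ => ((|k| ^ γ : ℝ) : ℂ) :=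
    Complex.continuous_ofReal.comp (continuous_abs.rpow_const fun _ => Or.inr hγ.le)
  rcases lt_trichotomy k 0 with h | h | h
  · refine (habs.continuousAt.mul continuousAt_const).congr (f := fun k => ((|k| ^ γ : ℝ) : ℂ) *
      Complex.exp (Complex.I * ((-1 * θ * Real.pi / 2 : ℝ) : ℂ))) ?_
    filter_upwards [Iio_mem_nhds h] with y hy
    rw [rfSymbol, Real.sign_of_neg hy]
  · subst h
    have h0 : rfSymbol γ θ 0 = 0 := by simp [rfSymbol, Real.zero_rpow hγ.ne']
    rw [ContinuousAt, h0, tendsto_zero_iff_norm_tendsto_zero]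
    have h1 : ∀ y, ‖rfSymbol γ θ y‖ = ‖((|y| ^ γ : ℝ) : ℂ)‖ := by
      intro y
      rw [rfSymbol, norm_mul, mul_comm Complex.I, Complex.norm_exp_ofReal_mul_I, mul_one]
    simp only [h1]
    have := (habs.norm).tendsto 0
    simpa [Real.zero_rpow hγ.ne'] using this
  · refine (habs.continuousAt.mul continuousAt_const).congr (f := fun k => ((|k| ^ γ : ℝ) : ℂ) *
      Complex.exp (Complex.I * ((1 * θ * Real.pi / 2 : ℝ) : ℂ))) ?_
    filter_upwards [Ioi_mem_nhds h] with y hy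
    rw [rfSymbol, Real.sign_of_pos hy]

theorem norm_rfSymbol (γ θ k : ℝ) : ‖rfSymbol γ θ k‖ = |k| ^ γ := by
  rw [rfSymbol, norm_mul, mul_comm Complex.I, Complex.norm_exp_ofReal_mul_I, mul_one,
    Complex.norm_real, Real.norm_of_nonneg (by positivity)]

theorem continuous_bSymbol {n : ℕ} {μ γ θ : Fin n → ℝ} (hγ : ∀ j, 0 < γ j) :
    Continuous (bSymbol μ γ θ) :=
  continuous_finsetSum _ fun j _ => continuous_const.mul (continuous_rfSymbol (hγ j))

theorem integrableOn_strip_iff {Φ : ℝ × ℝ → ℂ} {T : ℝ} :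
    IntegrableOn Φ (Set.univ ×ˢ Set.Ioc 0 T) ↔
      Integrable Φ (volume.prod (volume.restrict (Set.Ioc 0 T))) := by
  rw [IntegrableOn, Measure.volume_eq_prod, ← Measure.prod_restrict, Measure.restrict_univ]

theorem integrableOn_fourierT {Φ : ℝ → ℝ → ℂ} {T : ℝ}
    (h : IntegrableOn (fun p : ℝ × ℝ => Φ p.1 p.2) (Set.univ ×ˢ Set.Ioc 0 T)) (k : ℝ) :
    IntegrableOn (fun s => fourierT (fun x => Φ x s) k) (Set.Ioc 0 T) := by
  rw [integrableOn_strip_iff] at h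
  have h1 := (integrable_cexp_mul
    (e := fun p : ℝ × ℝ => Complex.exp (Complex.I * (k : ℂ) * (p.1 : ℂ)))
      h (by fun_prop) (fun p => norm_cexp_I_mul k p.1)).integral_prod_right
  exact h1.const_mul _

/-- For order at least one the kernel is bounded, so it preserves integrability on a strip. -/
theorem integrableOn_rlKernel_mul {Φ : ℝ → ℝ → ℂ} {σ T : ℝ} (hσ : 1 ≤ σ)
    (h : IntegrableOn (fun p : ℝ × ℝ => Φ p.1 p.2) (Set.univ ×ˢ Set.Ioc 0 T)) :
    IntegrableOn (fun p : ℝ × ℝ => (rlKernel σ (T - p.2) : ℂ) * Φ p.1 p.2)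
      (Set.univ ×ˢ Set.Ioc 0 T) := by
  refine Integrable.bdd_mul (c := rlKernel σ T) h ?_ ?_
  · have := (measurable_rlKernel σ).comp (by fun_prop : Measurable fun p : ℝ × ℝ => T - p.2)
    exact (Complex.measurable_ofReal.comp this).aestronglyMeasurable
  · filter_upwards [ae_restrict_mem (MeasurableSet.univ.prod measurableSet_Ioc)] with p hp
    have h1 : p.2 ∈ Set.Ioc 0 T := hp.2
    rw [Complex.norm_real, Real.norm_of_nonneg (rlKernel_nonneg (by linarith) (by linarith [h1.2]))]
    exact rlKernel_le hσ (by linarith [h1.2]) (by linarith [h1.1])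

/-- For any positive order it suffices in addition that the spatial `L¹` norm is continuous at
positive times, which controls the singularity of the kernel at `s = T`. -/
theorem integrableOn_rlKernel_mul_of_continuousOn {Φ : ℝ → ℝ → ℂ} {σ T : ℝ} (hσ : 0 < σ)
    (hT : 0 < T)
    (h : IntegrableOn (fun p : ℝ × ℝ => Φ p.1 p.2) (Set.univ ×ˢ Set.Ioc 0 T))
    (hi : ∀ t, 0 < t → Integrable fun x => Φ x t)
    (hc : ContinuousOn (fun t => ∫ x, ‖Φ x t‖) (Set.Ioi 0)) :
    IntegrableOn (fun p : ℝ × ℝ => (rlKernel σ (T - p.2) : ℂ) * Φ p.1 p.2)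
      (Set.univ ×ˢ Set.Ioc 0 T) := by
  rw [integrableOn_strip_iff] at h ⊢
  have hk : Measurable fun s => rlKernel σ (T - s) :=
    (measurable_rlKernel σ).comp (by fun_prop)
  have hmeas : AEStronglyMeasurable (fun p : ℝ × ℝ => (rlKernel σ (T - p.2) : ℂ) * Φ p.1 p.2)
      (volume.prod (volume.restrict (Set.Ioc 0 T))) :=
    (Complex.measurable_ofReal.comp (hk.comp measurable_snd)).aestronglyMeasurable.mul h.1
  rw [integrable_prod_iff' hmeas]
  constructor
  · filter_upwards [ae_restrict_mem measurableSet_Ioc] with s hs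
    exact (hi s hs.1).const_mul _
  · have h1 : IntegrableOn (fun s => rlKernel σ (T - s) * ∫ x, ‖Φ x s‖) (Set.Ioc 0 T) := by
      rw [← intervalIntegrable_iff_integrableOn_Ioc_of_le hT.le]
      have hT2 : 0 < T / 2 := by linarith
      refine IntervalIntegrable.trans (b := T / 2) ?_ ?_
      · refine IntervalIntegrable.continuousOn_mul ?_ ?_
        · rw [intervalIntegrable_iff_integrableOn_Ioc_of_le hT2.le]
          exact (IntegrableOn.mono_set h.norm.integral_prod_right
            (Set.Ioc_subset_Ioc_right (by linarith)))
        · intro s hs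
          rw [Set.uIcc_of_le hT2.le] at hs
          refine ContinuousAt.continuousWithinAt ?_
          refine ContinuousAt.div_const ?_ _
          refine ContinuousAt.rpow_const (by fun_prop) (Or.inl ?_)
          linarith [hs.2]
      · refine IntervalIntegrable.mul_continuousOn ?_ (hc.mono ?_)
        · have h2 := intervalIntegrable_rlKernel_mul_shift hσ one_pos hT
          simp only [rlKernel_one, mul_one] at h2
          refine h2.mono_set ?_
          rw [Set.uIcc_of_le hT.le, Set.uIcc_of_le (by linarith)]
          exact Set.Icc_subset_Icc hT2.le le_rfl
        · intro s hs
          rw [Set.uIcc_of_le (by linarith)] at hs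
          exact hT2.trans_le hs.1
    refine Integrable.congr h1 ?_
    filter_upwards [ae_restrict_mem measurableSet_Ioc] with s hs
    simp only [norm_mul, Complex.norm_real]
    rw [integral_const_mul, Real.norm_of_nonneg (rlKernel_nonneg hσ (by linarith [hs.2]))]

section
variable {m : ℕ} {α β lam : ℝ} {μ γ θ : Fin m → ℝ} {φ N : ℝ → ℝ → ℂ}

theorem IsSolution.continuousOn_fourierT (hN : IsSolution α β lam μ γ θ φ N) (k : ℝ) :
    ContinuousOn (fun t => fourierT (fun x => N x t) k) (Set.Ioi 0) := by
  intro t ht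
  refine ContinuousAt.continuousWithinAt ?_
  rw [ContinuousAt, tendsto_iff_norm_sub_tendsto_zero]
  have h := (hN.continuous_L1 t ht).const_mul (1 / Real.sqrt (2 * Real.pi))
  rw [mul_zero] at h
  refine squeeze_zero' (Eventually.of_forall fun _ => norm_nonneg _) ?_ h
  filter_upwards [Ioi_mem_nhds (show 0 < t from ht)] with s hs
  rw [← fourierT_sub (hN.integrable_space s hs) (hN.integrable_space t ht)]
  exact norm_fourierT_le _ k

theorem IsSolution.continuousOn_norm (hN : IsSolution α β lam μ γ θ φ N) :
    ContinuousOn (fun t => ∫ x, ‖N x t‖) (Set.Ioi 0) := by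
  intro t ht
  refine ContinuousAt.continuousWithinAt ?_
  rw [ContinuousAt, tendsto_iff_norm_sub_tendsto_zero]
  refine squeeze_zero' (Eventually.of_forall fun _ => norm_nonneg _) ?_ (hN.continuous_L1 t ht)
  filter_upwards [Ioi_mem_nhds (show 0 < t from ht)] with s hs
  have h1 := hN.integrable_space s hs
  have h2 := hN.integrable_space t ht
  rw [← integral_sub h1.norm h2.norm]
  refine (norm_integral_le_integral_norm _).trans ?_
  exact integral_mono (h1.norm.sub h2.norm).norm (h1.sub h2).norm
    fun x => abs_norm_sub_norm_le _ _

/-- The Fourier transform commutes with the Riemann-Liouville integral in time. -/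
theorem IsSolution.fourierT_rlIntegral (hN : IsSolution α β lam μ γ θ φ N) {σ T : ℝ}
    (hσ : 0 ≤ σ) (hT : 0 < T) :
    Integrable (fun x => rlIntegral σ (N x) T) ∧ ∀ k, fourierT (fun x => rlIntegral σ (N x) T) k =
      rlIntegral σ (fun t => fourierT (fun x => N x t) k) T := by
  rcases hσ.eq_or_lt with rfl | hσ
  · simp only [rlIntegral_zero]
    exact ⟨hN.integrable_space T hT, fun _ => trivial⟩
  · simp only [rlIntegral_eq hσ.ne']
    have h := integrableOn_rlKernel_mul_of_continuousOn hσ hT (hN.integrable_strip T hT)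
      hN.integrable_space hN.continuousOn_norm
    exact ⟨integrable_timeIntegral (w := fun s => (rlKernel σ (T - s) : ℂ)) hT.le h,
      fourierT_timeIntegral (w := fun s => (rlKernel σ (T - s) : ℂ)) hT.le h⟩

/-- The time integral of a Riesz-Feller derivative is again one. -/
theorem IsSolution.integral_rieszFeller (hN : IsSolution α β lam μ γ θ φ N) (j : Fin m) {T : ℝ}
    (hT : 0 < T) :
    Integrable (fun k => -(rfSymbol (γ j) (θ j) k) *
      rlIntegral 2 (fun t => fourierT (fun x => N x t) k) T) ∧ ∀ x,
    IntegrableOn (fun s => rieszFeller (γ j) (θ j) (fun y => N y s) x) (Set.Ioc 0 T) ∧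
    rlIntegral 2 (fun s => rieszFeller (γ j) (θ j) (fun y => N y s) x) T =
      fourierInvT (fun k => -(rfSymbol (γ j) (θ j) k) *
        rlIntegral 2 (fun t => fourierT (fun x => N x t) k) T) x := by
  have h0 : IntegrableOn (fun p : ℝ × ℝ => -(rfSymbol (γ j) (θ j) p.1) *
      fourierT (fun x => N x p.2) p.1) (Set.univ ×ˢ Set.Ioc 0 T) := by
    refine (hN.integrable_symbol_strip j T hT).neg.congr (ae_of_all _ fun p => ?_)
    simp only [Pi.neg_apply, neg_mul]
  have h1 := integrableOn_rlKernel_mul (Φ := fun k s => -(rfSymbol (γ j) (θ j) k) *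
      fourierT (fun x => N x s) k) one_le_two h0
  have e1 : ∀ k, -(rfSymbol (γ j) (θ j) k) *
      rlIntegral 2 (fun t => fourierT (fun x => N x t) k) T =
      ∫ s in (0 : ℝ)..T, (rlKernel 2 (T - s) : ℂ) * (-(rfSymbol (γ j) (θ j) k) *
        fourierT (fun x => N x s) k) := by
    intro k
    rw [rlIntegral_eq two_ne_zero, ← intervalIntegral.integral_const_mul]
    congr 1
    funext s
    ring
  simp only [e1]
  refine ⟨integrable_timeIntegral (w := fun s => (rlKernel 2 (T - s) : ℂ)) hT.le h1,
    fun x => ⟨?_, ?_⟩⟩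
  · have := integrableOn_fourierT (Φ := fun k s => -(rfSymbol (γ j) (θ j) k) *
      fourierT (fun x => N x s) k) h0 (-x)
    exact this.congr (ae_of_all _ fun s => fourierT_neg _ _)
  · rw [fourierInvT_timeIntegral (w := fun s => (rlKernel 2 (T - s) : ℂ)) hT.le h1,
      rlIntegral_eq two_ne_zero]
    rfl

end

section
variable {m : ℕ} {α β lam : ℝ} {μ γ θ : Fin m → ℝ} {φ N : ℝ → ℝ → ℂ} {f₁ g₁ f₂ g₂ : ℝ → ℂ}

theorem ae_integrableOn_Ioc
    (hφ : ∀ T : ℝ, 0 < T →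
      IntegrableOn (fun p : ℝ × ℝ => φ p.1 p.2) (Set.univ ×ˢ Set.Ioc 0 T)) :
    ∀ᵐ x : ℝ, ∀ T : ℝ, 0 < T → IntegrableOn (φ x) (Set.Ioc 0 T) := by
  have h : ∀ n : ℕ, ∀ᵐ x : ℝ, IntegrableOn (φ x) (Set.Ioc 0 ((n : ℝ) + 1)) := fun n =>
    (integrableOn_strip_iff.1 (hφ ((n : ℝ) + 1) (by positivity))).prod_right_ae
  filter_upwards [ae_all_iff.2 h] with x hx T _
  obtain ⟨n, hn⟩ := exists_nat_ge T
  exact (hx n).mono_set (Set.Ioc_subset_Ioc_right (by linarith))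

/-- For almost every `x`, the equation integrated twice in time. Exceptional `x` are those where
`φ(x, ·)` fails to be integrable near `t = 0`. -/
theorem IsSolution.integrated (hN : IsSolution α β lam μ γ θ φ N)
    (hinit : HasInitialData α β lam f₁ g₁ f₂ g₂ N)
    (hα : 1 < α) (hα2 : α ≤ 2) (hβ : 1 < β) (hβ2 : β ≤ 2)
    (hφ : ∀ T : ℝ, 0 < T →
      IntegrableOn (fun p : ℝ × ℝ => φ p.1 p.2) (Set.univ ×ˢ Set.Ioc 0 T)) :
    ∀ᵐ x : ℝ, ∀ T : ℝ, 0 < T →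
      rlIntegral (2 - α) (N x) T + lam * rlIntegral (2 - β) (N x) T =
        (g₁ x + lam * g₂ x) + (T : ℂ) * (f₁ x + lam * f₂ x) +
        (∑ j, (μ j : ℂ) *
          rlIntegral 2 (fun s => rieszFeller (γ j) (θ j) (fun y => N y s) x) T) +
        rlIntegral 2 (φ x) T := by
  filter_upwards [ae_integrableOn_Ioc hφ] with x hx T hT
  have hdα := hN.differentiable_alpha x
  have hdβ := hN.differentiable_beta x
  have heq := hN.equation x
  have h1 := hinit.first x
  have h2 := hinit.second x
  rw [rlDeriv_sub_two hα2, rlDeriv_sub_one hα hα2] at hdα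
  rw [rlDeriv_sub_two hβ2, rlDeriv_sub_one hβ hβ2] at hdβ
  rw [rlDeriv_sub_one hα hα2, rlDeriv_sub_one hβ hβ2] at h1
  rw [rlDeriv_sub_two hα2, rlDeriv_sub_two hβ2] at h2
  rw [rlDeriv_eq_deriv_deriv hα hα2, rlDeriv_eq_deriv_deriv hβ hβ2] at heq
  set F : ℝ → ℂ := fun t => rlIntegral (2 - α) (N x) t + lam * rlIntegral (2 - β) (N x) t with hF
  set ρ : ℝ → ℂ := fun t =>
    ∑ j, (μ j : ℂ) * rieszFeller (γ j) (θ j) (fun y => N y t) x + φ x t with hρdef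
  have hFd : ∀ t, 0 < t → HasDerivAt F (deriv (rlIntegral (2 - α) (N x)) t +
      lam * deriv (rlIntegral (2 - β) (N x)) t) t := fun t ht =>
    (hdα t ht).1.hasDerivAt.add ((hdβ t ht).1.hasDerivAt.const_mul _)
  have hFdd : ∀ t, 0 < t → HasDerivAt (deriv F) (ρ t) t := by
    intro t ht
    rw [hρdef]
    simp only
    rw [← heq t ht]
    refine ((hdα t ht).2.hasDerivAt.add
      ((hdβ t ht).2.hasDerivAt.const_mul (lam : ℂ))).congr_of_eventuallyEq ?_
    filter_upwards [Ioi_mem_nhds ht] with s hs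
    exact (hFd s hs).deriv
  have hRF : ∀ j, IntegrableOn (fun s => (μ j : ℂ) *
      rieszFeller (γ j) (θ j) (fun y => N y s) x) (Set.Ioc 0 T) := fun j =>
    ((hN.integral_rieszFeller j hT).2 x).1.const_mul _
  have hRFs : IntegrableOn (fun s => ∑ j, (μ j : ℂ) *
      rieszFeller (γ j) (θ j) (fun y => N y s) x) (Set.Ioc 0 T) :=
    integrable_finsetSum _ fun j _ => hRF j
  have hρ : IntegrableOn ρ (Set.Ioc 0 T) := hRFs.add (hx T hT)
  have hf : Tendsto (deriv F) (𝓝[>] 0) (𝓝 (f₁ x + lam * f₂ x)) := by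
    refine h1.congr' ?_
    filter_upwards [self_mem_nhdsWithin] with t ht
    exact (hFd t ht).deriv.symm
  have key := taylor_two hT (fun t ht => (hFd t ht).differentiableAt) hFdd hρ h2 hf
  have e1 : ∫ s in (0 : ℝ)..T, ((T - s : ℝ) : ℂ) * ρ s =
      (∑ j, (μ j : ℂ) *
        rlIntegral 2 (fun s => rieszFeller (γ j) (θ j) (fun y => N y s) x) T) +
        rlIntegral 2 (φ x) T := by
    have hk : ∀ u : ℝ → ℂ, IntegrableOn u (Set.Ioc 0 T) →
        IntervalIntegrable (fun s => ((T - s : ℝ) : ℂ) * u s) volume 0 T := by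
      intro u hu
      have h := intervalIntegrable_rlKernel_mul (one_le_two (α := ℝ)) hT hu
      simpa only [rlKernel_two] using h
    simp only [rlIntegral_eq two_ne_zero, rlKernel_two]
    have hi : ∀ j ∈ Finset.univ, IntervalIntegrable (fun s => ((T - s : ℝ) : ℂ) * ((μ j : ℂ) *
        rieszFeller (γ j) (θ j) (fun y => N y s) x)) volume 0 T := fun j _ => hk _ (hRF j)
    have hs := hk _ hRFs
    have hφi := hk _ (hx T hT)
    simp only [hρdef, mul_add]
    rw [intervalIntegral.integral_add hs hφi]
    simp only [Finset.mul_sum]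
    rw [intervalIntegral.integral_finsetSum hi]
    simp only [mul_left_comm _ (μ _ : ℂ), intervalIntegral.integral_const_mul]
  rw [e1, ← add_assoc] at key
  exact key

/-- The Fourier modes of a solution satisfy the integrated mode equation. -/
theorem IsSolution.isMode (hN : IsSolution α β lam μ γ θ φ N)
    (hinit : HasInitialData α β lam f₁ g₁ f₂ g₂ N)
    (hα : 1 < α) (hα2 : α ≤ 2) (hβ : 1 < β) (hβ2 : β ≤ 2) (hγ : ∀ j, 0 < γ j)
    (hf₁ : Integrable f₁) (hg₁ : Integrable g₁) (hf₂ : Integrable f₂) (hg₂ : Integrable g₂)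
    (hφ : ∀ T : ℝ, 0 < T →
      IntegrableOn (fun p : ℝ × ℝ => φ p.1 p.2) (Set.univ ×ˢ Set.Ioc 0 T)) (k : ℝ) :
    IsMode α β lam (bSymbol μ γ θ k) (fourierT f₁ k + lam * fourierT f₂ k)
      (fourierT g₁ k + lam * fourierT g₂ k) (fun t => fourierT (fun x => φ x t) k)
      (fun t => fourierT (fun x => N x t) k) := by
  intro T hT
  obtain ⟨iα, fα⟩ := hN.fourierT_rlIntegral (by linarith : 0 ≤ 2 - α) hT
  obtain ⟨iβ, fβ⟩ := hN.fourierT_rlIntegral (by linarith : 0 ≤ 2 - β) hT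
  obtain ⟨i2, f2⟩ := hN.fourierT_rlIntegral (zero_le_two) hT
  have hφT := integrableOn_rlKernel_mul one_le_two (hφ T hT)
  have iφ : Integrable (fun x => rlIntegral 2 (φ x) T) := by
    simp only [rlIntegral_eq two_ne_zero]
    exact integrable_timeIntegral (w := fun s => (rlKernel 2 (T - s) : ℂ)) hT.le hφT
  have fφ : fourierT (fun x => rlIntegral 2 (φ x) T) k =
      rlIntegral 2 (fun t => fourierT (fun x => φ x t) k) T := by
    simp only [rlIntegral_eq two_ne_zero]
    exact fourierT_timeIntegral (w := fun s => (rlKernel 2 (T - s) : ℂ)) hT.le hφT k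
  -- The Riesz-Feller terms, integrated twice in time, form the inverse transform of `h = -b n₂`.
  set n₂ : ℝ → ℂ := fun k => rlIntegral 2 (fun t => fourierT (fun x => N x t) k) T with hn₂
  have hn₂c : Continuous n₂ := by
    have : n₂ = fourierT fun x => rlIntegral 2 (N x) T := funext fun k => (f2 k).symm
    rw [this]
    exact continuous_fourierT i2
  set h : ℝ → ℂ := fun k => -(bSymbol μ γ θ k) * n₂ k with hh
  have hhc : Continuous h := (continuous_bSymbol hγ).neg.mul hn₂c
  have hsum : h = fun k => ∑ j, (μ j : ℂ) * (-(rfSymbol (γ j) (θ j) k) * n₂ k) := by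
    funext k
    simp only [hh, bSymbol, ← Finset.sum_neg_distrib, Finset.sum_mul]
    exact Finset.sum_congr rfl fun j _ => by ring
  have hhi : Integrable h := by
    rw [hsum]
    exact integrable_finsetSum _ fun j _ => (hN.integral_rieszFeller j hT).1.const_mul _
  have hinv : ∀ x, fourierInvT h x = ∑ j, (μ j : ℂ) *
      rlIntegral 2 (fun s => rieszFeller (γ j) (θ j) (fun y => N y s) x) T := by
    intro x
    rw [fourierInvT, hsum]
    simp only [Finset.mul_sum]
    rw [integral_finsetSum, Finset.mul_sum]
    · refine Finset.sum_congr rfl fun j _ => ?_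
      rw [((hN.integral_rieszFeller j hT).2 x).2, fourierInvT]
      simp only [mul_left_comm _ (μ j : ℂ), integral_const_mul, hn₂]
    · exact fun j _ => integrable_cexp_mul ((hN.integral_rieszFeller j hT).1.const_mul _)
        (by fun_prop) (fun k => norm_cexp_neg_I_mul k x)
  have hF := iα.add (iβ.const_mul (lam : ℂ))
  have hg := hg₁.add (hg₂.const_mul (lam : ℂ))
  have hf := hf₁.add (hf₂.const_mul (lam : ℂ))
  -- By the integrated equation that inverse transform is integrable in `x`.
  have hP := ((hF.sub hg).sub (hf.const_mul (T : ℂ))).sub iφ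
  have hae : fourierInvT h =ᵐ[volume] fun x =>
      rlIntegral (2 - α) (N x) T + lam * rlIntegral (2 - β) (N x) T - (g₁ x + lam * g₂ x) -
        (T : ℂ) * (f₁ x + lam * f₂ x) - rlIntegral 2 (φ x) T := by
    filter_upwards [hN.integrated hinit hα hα2 hβ hβ2 hφ] with x hx
    rw [hinv, hx T hT]
    ring
  have key := fourierT_fourierInvT hhi hhc (hP.congr hae.symm) k
  rw [fourierT_congr_ae hae, fourierT_sub, fourierT_sub, fourierT_sub, fourierT_add,
    fourierT_add, fourierT_const_mul, fourierT_const_mul, fourierT_const_mul, fourierT_add,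
    fourierT_const_mul, fα, fβ, fφ] at key
  · rw [rlIntegral_sub_const_mul one_le_two hT (integrableOn_fourierT (hφ T hT) k)
      (integrableOn_fourierT (hN.integrable_strip T hT) k)]
    simp only [hh, hn₂] at key
    linear_combination key
  · exact hf₁
  · exact hf₂.const_mul _
  · exact hg₁
  · exact hg₂.const_mul _
  · exact iα
  · exact iβ.const_mul _
  · exact hF
  · exact hg
  · exact hF.sub hg
  · exact hf.const_mul _
  · exact (hF.sub hg).sub (hf.const_mul _)
  · exact iφ

end

/-! ### Summation over the power of `λ` -/

/-- The pointwise sum of an absolutely convergent series of integrals is integrable. -/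
theorem AbsConv.integrable {c : ℕ → ℝ → ℂ} {v : ℝ → ℂ} (hc : AbsConv c)
    (hv : ∀ k, HasSum (fun r => c r k) (v k)) : Integrable v := by
  refine ⟨aestronglyMeasurable_of_tendsto_ae (u := atTop)
    (f := fun n k => ∑ r ∈ Finset.range n, c r k)
    (fun n => ?_) (ae_of_all _ fun k => (hv k).tendsto_sum_nat), ?_⟩
  · exact Finset.aestronglyMeasurable_fun_sum _ fun r _ => (hc.1 r).1
  · refine lt_of_le_of_lt (b := ∑' r, ∫⁻ k, ‖c r k‖ₑ) ?_ ?_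
    · rw [← lintegral_tsum fun r => (hc.1 r).1.enorm]
      refine lintegral_mono fun k => ?_
      rw [← (hv k).tsum_eq]
      exact enorm_tsum_le_tsum_enorm
    · simp only [← ofReal_integral_norm_eq_lintegral_enorm (hc.1 _)]
      rw [← ENNReal.ofReal_tsum_of_nonneg (fun r => integral_nonneg fun k => norm_nonneg _) hc.2]
      exact ENNReal.ofReal_lt_top

theorem AbsConv.hasSum_fourierInvT {c : ℕ → ℝ → ℂ} {v : ℝ → ℂ} (hc : AbsConv c)
    (hv : ∀ k, HasSum (fun r => c r k) (v k)) (x : ℝ) :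
    HasSum (fun r => fourierInvT (c r) x) (fourierInvT v x) := by
  have h := hasSum_integral_of_summable_integral_norm
    (F := fun r (k : ℝ) => Complex.exp (-Complex.I * (k : ℂ) * (x : ℂ)) * c r k)
    (fun r => integrable_cexp_mul (hc.1 r) (by fun_prop) (fun k => norm_cexp_neg_I_mul k x))
    (by simpa only [norm_mul, norm_cexp_neg_I_mul, one_mul] using hc.2)
  simp only [tsum_mul_left, (hv _).tsum_eq] at h
  exact h.mul_left _

/-- Absolute convergence follows from pointwise majorants whose sums are dominated by one integrable
function. -/
theorem absConv_of_bound {c : ℕ → ℝ → ℂ} {G : ℝ → ℝ} (hG : Integrable G)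
    (hc : ∀ r, AEStronglyMeasurable (c r))
    (h : ∀ k, ∃ e : ℕ → ℝ, Summable e ∧ (∀ r, ‖c r k‖ ≤ e r) ∧ ∑' r, e r ≤ G k) :
    AbsConv c := by
  have hi : ∀ r, Integrable (c r) := fun r => by
    refine hG.mono' (hc r) (ae_of_all _ fun k => ?_)
    obtain ⟨e, he, hce, heG⟩ := h k
    exact (hce r).trans ((he.le_tsum r fun i _ => (norm_nonneg _).trans (hce i)).trans heG)
  refine ⟨hi, summable_of_sum_range_le (c := ∫ k, G k)
    (fun r => integral_nonneg fun k => norm_nonneg _) fun R => ?_⟩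
  rw [← integral_finsetSum _ fun r _ => (hi r).norm]
  refine integral_mono (integrable_finsetSum _ fun r _ => (hi r).norm) hG fun k => ?_
  obtain ⟨e, he, hce, heG⟩ := h k
  calc ∑ r ∈ Finset.range R, ‖c r k‖ ≤ ∑ r ∈ Finset.range R, e r :=
        Finset.sum_le_sum fun r _ => hce r
    _ ≤ ∑' r, e r := he.sum_le_tsum _ fun i _ => (norm_nonneg _).trans (hce i)
    _ ≤ G k := heG

theorem measurable_mittagLeffler {α σ : ℝ} (hα : 0 < α) (hσ : 0 < σ) (r : ℕ) :
    Measurable (mittagLeffler α σ (r + 1)) := by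
  refine measurable_of_tendsto_metrizable (f := fun n z => ∑ m ∈ Finset.range n,
    (((ascPochhammer ℝ m).eval ((r : ℝ) + 1) / (Real.Gamma (α * m + σ) * m.factorial) : ℝ) : ℂ) *
      z ^ m) (fun n => ?_) (tendsto_pi_nhds.2 fun z => ?_)
  · exact Finset.measurable_fun_sum _ fun m _ => by fun_prop
  · refine (Summable.hasSum ?_).tendsto_sum_nat
    -- A row of the double series with `λ = 1/2`, `δ = 0` and `t = 1`.
    have h := (summable_mlTerm (δ := 0) (lam := 1 / 2) hα le_rfl
      (fun _ => by rw [abs_of_pos] <;> norm_num) hσ one_pos (-z)).prod_factor r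
    have h2 := h.mul_left (((-((1 / 2 : ℝ) : ℂ)) ^ r)⁻¹)
    have hne : (-((1 / 2 : ℝ) : ℂ)) ^ r ≠ 0 := pow_ne_zero _ (by norm_num)
    refine h2.congr fun m => ?_
    rw [div_mul_eq_div_div_swap, ascPochhammer_div_factorial, mlTerm, mlCoeff, rlKernel, mlExp]
    simp only [Real.one_rpow, zero_mul, add_zero, neg_neg]
    rw [mul_assoc, mul_assoc, inv_mul_cancel_left₀ hne]
    push_cast
    ring

/-- The part of `mlKernel` of degree `r` in `λ`. -/
def mlRow (α δ lam : ℝ) (b : ℂ) (σ t : ℝ) (r : ℕ) : ℂ :=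
  (-(lam : ℂ)) ^ r * ((t ^ (δ * r + σ - 1) : ℝ) : ℂ) *
    mittagLeffler α (σ + δ * r) (r + 1) (-b * ((t ^ α : ℝ) : ℂ))

theorem measurable_mlRow {X : Type*} [MeasurableSpace X] {α δ lam σ : ℝ} (hα : 0 < α) (hδ : 0 ≤ δ)
    (hσ : 0 < σ) {b : X → ℂ} {t : X → ℝ} (hb : Measurable b) (ht : Measurable t) (r : ℕ) :
    Measurable fun x => mlRow α δ lam (b x) σ (t x) r := by
  unfold mlRow
  refine Measurable.mul (by fun_prop) ?_
  exact (measurable_mittagLeffler hα (by positivity) r).comp (by fun_prop)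

theorem exists_mlRow_bound {α δ lam σ T : ℝ} (hα : 0 < α) (hδ : 0 ≤ δ)
    (hlam : δ = 0 → |lam| < 1) (hσ : 0 < σ) (hT : 0 < T) :
    ∃ C c : ℝ, 0 ≤ C ∧ 0 < c ∧ ∀ B : ℝ, 0 ≤ B → ∃ e : ℕ → ℝ, (∀ r, 0 ≤ e r) ∧ Summable e ∧
      ∑' r, e r ≤ C * Real.exp (c * B ^ (1 / α)) ∧
      ∀ b : ℂ, ‖b‖ ≤ B → ∀ t : ℝ, 0 < t → t ≤ T → ∀ r,
        ‖mlRow α δ lam b σ t r‖ ≤ t ^ (σ - 1) * e r := by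
  obtain ⟨C, c, hC, hc, h⟩ := exists_mlTerm_bound (lam := lam) hα hδ hlam hσ hT
  refine ⟨C, c, hC, hc, fun B hB => ?_⟩
  obtain ⟨d, hd0, hd, hdC, hb⟩ := h B hB
  refine ⟨fun r => ∑' m, d (r, m), fun r => tsum_nonneg fun m => hd0 _, hd.prod, ?_, ?_⟩
  · rwa [← hd.tsum_prod]
  · intro b hbB t ht htT r
    rw [mlRow, ← tsum_mlTerm_row ht, ← tsum_mul_left]
    exact tsum_of_norm_bounded ((hd.prod_factor r).mul_left _).hasSum fun m =>
      hb b hbB t ht htT (r, m)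

theorem hasSum_mlRow_conv {α δ lam σ t : ℝ} (hα : 0 < α) (hδ : 0 ≤ δ)
    (hlam : δ = 0 → |lam| < 1) (hσ : 1 ≤ σ) (ht : 0 < t) (b : ℂ) {u : ℝ → ℂ}
    (hu : IntegrableOn u (Set.Ioc 0 t)) :
    HasSum (fun r => ∫ s in (0 : ℝ)..t, mlRow α δ lam b σ (t - s) r * u s)
      (∫ s in (0 : ℝ)..t, mlKernel α δ lam b σ (t - s) * u s) := by
  have hσ0 : 0 < σ := by linarith
  obtain ⟨C, c, -, -, h⟩ := exists_mlRow_bound (lam := lam) hα hδ hlam hσ0 ht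
  obtain ⟨e, he0, he, -, hb⟩ := h ‖b‖ (norm_nonneg b)
  have hne : ∀ᵐ s : ℝ, s ≠ t := compl_mem_ae_iff.2 (measure_singleton t)
  refine intervalIntegral.hasSum_integral_of_dominated_convergence
    (fun r s => t ^ (σ - 1) * e r * ‖u s‖) ?_ ?_ ?_ ?_ ?_
  · intro r
    rw [Set.uIoc_of_le ht.le]
    exact (measurable_mlRow hα hδ hσ0 measurable_const (by fun_prop) r).aestronglyMeasurable.mul
      hu.1
  · intro r
    filter_upwards [hne] with s hs hst
    rw [Set.uIoc_of_le ht.le] at hst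
    have h1 : 0 < t - s := sub_pos.2 (lt_of_le_of_ne hst.2 hs)
    rw [norm_mul]
    gcongr
    exact (hb b le_rfl (t - s) h1 (by linarith [hst.1]) r).trans (mul_le_mul_of_nonneg_right
      (rpow_le_rpow_of_one_le hσ h1.le (by linarith [hst.1])) (he0 r))
  · exact ae_of_all _ fun s _ => (he.mul_left _).mul_right _
  · rw [intervalIntegrable_iff_integrableOn_Ioc_of_le ht.le]
    simp only [tsum_mul_right]
    exact hu.norm.const_mul _
  · filter_upwards [hne] with s hs hst
    rw [Set.uIoc_of_le ht.le] at hst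
    exact (hasSum_mittagLeffler hα hδ hlam hσ0
      (sub_pos.2 (lt_of_le_of_ne hst.2 hs)) b).mul_right _

/-- The Fourier transform in `x` of a function integrable on a strip is jointly measurable. -/
theorem aestronglyMeasurable_fourierT {Φ : ℝ → ℝ → ℂ} {T : ℝ}
    (h : IntegrableOn (fun p : ℝ × ℝ => Φ p.1 p.2) (Set.univ ×ˢ Set.Ioc 0 T)) :
    AEStronglyMeasurable (fun p : ℝ × ℝ => fourierT (fun x => Φ x p.2) p.1)
      (volume.prod (volume.restrict (Set.Ioc 0 T))) := by
  rw [integrableOn_strip_iff] at h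
  set Φ' := h.1.mk with hΦ'
  have hm : StronglyMeasurable Φ' := h.1.stronglyMeasurable_mk
  have hswap : ∀ᵐ q : ℝ × ℝ ∂((volume.restrict (Set.Ioc 0 T)).prod volume),
      Φ q.2 q.1 = Φ' (q.2, q.1) :=
    (Measure.measurePreserving_swap (μ := volume.restrict (Set.Ioc 0 T))
      (ν := (volume : Measure ℝ))).quasiMeasurePreserving.ae h.1.ae_eq_mk
  have hae : ∀ᵐ s ∂(volume.restrict (Set.Ioc 0 T)), ∀ k,
      fourierT (fun x => Φ x s) k = fourierT (fun x => Φ' (x, s)) k := by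
    filter_upwards [Measure.ae_ae_of_ae_prod hswap] with s hs k
    exact fourierT_congr_ae hs k
  refine AEStronglyMeasurable.congr
    (f := fun p : ℝ × ℝ => fourierT (fun x => Φ' (x, p.2)) p.1) ?_ ?_
  · refine StronglyMeasurable.aestronglyMeasurable ?_
    unfold fourierT
    refine StronglyMeasurable.const_mul ?_ _
    refine StronglyMeasurable.integral_prod_right (f := fun (p : ℝ × ℝ) (x : ℝ) =>
      Complex.exp (Complex.I * (p.1 : ℂ) * (x : ℂ)) * Φ' (x, p.2)) ?_
    refine StronglyMeasurable.mul (Continuous.stronglyMeasurable (by fun_prop)) ?_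
    exact hm.comp_measurable (by fun_prop : Measurable fun q : (ℝ × ℝ) × ℝ => (q.2, q.1.2))
  · filter_upwards [Measure.quasiMeasurePreserving_snd.ae hae] with p hp
    exact (hp p.1).symm

/-! ### Convergence of the solution formula -/

theorem norm_bSymbol_le {n : ℕ} {μ γ θ : Fin n → ℝ} (hμ : ∀ j, 0 < μ j) (k : ℝ) :
    ‖bSymbol μ γ θ k‖ ≤ ∑ j, μ j * |k| ^ γ j := by
  refine (norm_sum_le _ _).trans (le_of_eq (Finset.sum_congr rfl fun j _ => ?_))
  rw [norm_mul, norm_rfSymbol, Complex.norm_real, Real.norm_of_nonneg (hμ j).le]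

theorem measurable_bSymbol {n : ℕ} {μ γ θ : Fin n → ℝ} (hγ : ∀ j, 0 < γ j) :
    Measurable (bSymbol μ γ θ) := (continuous_bSymbol hγ).measurable

theorem fourierInvT_const_mul (a : ℂ) (h : ℝ → ℂ) (x : ℝ) :
    fourierInvT (fun k => a * h k) x = a * fourierInvT h x := by
  rw [← fourierT_neg, fourierT_const_mul, fourierT_neg]

theorem fourierInvT_add {f g : ℝ → ℂ} (hf : Integrable f) (hg : Integrable g) (x : ℝ) :
    fourierInvT (fun k => f k + g k) x = fourierInvT f x + fourierInvT g x := by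
  simp only [← fourierT_neg]
  exact fourierT_add hf hg _

section
variable {α β lam t : ℝ}

theorem mul_mlRow_eq (b F : ℂ) (r : ℕ) :
    (-(lam : ℂ)) ^ r * ((t ^ ((α - β) * r + α - 1) : ℝ) : ℂ) *
      (F * mittagLeffler α (α + (α - β) * r) (r + 1) (-b * ((t ^ α : ℝ) : ℂ))) =
      F * mlRow α (α - β) lam b α t r := by
  rw [mlRow]; ring

theorem mul_mlRow_sub_one_eq (b G : ℂ) (r : ℕ) :
    (-(lam : ℂ)) ^ r * ((t ^ ((α - β) * r + α - 2) : ℝ) : ℂ) *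
      (G * mittagLeffler α (α + (α - β) * r - 1) (r + 1) (-b * ((t ^ α : ℝ) : ℂ))) =
      G * mlRow α (α - β) lam b (α - 1) t r := by
  rw [mlRow, show (α - β) * (r : ℝ) + (α - 1) - 1 = (α - β) * r + α - 2 by ring,
    show α - 1 + (α - β) * (r : ℝ) = α + (α - β) * r - 1 by ring]
  ring

theorem integral_mlRow_eq (b : ℂ) (φ : ℝ → ℝ → ℂ) (k : ℝ) (r : ℕ) :
    (-(lam : ℂ)) ^ r * ∫ ξ in (0 : ℝ)..t, fourierT (fun y => φ y (t - ξ)) k *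
      ((ξ ^ ((α - β) * r + α - 1) : ℝ) : ℂ) *
      mittagLeffler α (α + (α - β) * r) (r + 1) (-b * ((ξ ^ α : ℝ) : ℂ)) =
      ∫ s in (0 : ℝ)..t, mlRow α (α - β) lam b α (t - s) r * fourierT (fun y => φ y s) k := by
  have h := intervalIntegral.integral_comp_sub_left
    (fun s => mlRow α (α - β) lam b α (t - s) r * fourierT (fun y => φ y s) k) t (a := 0) (b := t)
  rw [sub_self, sub_zero] at h
  rw [← h, ← intervalIntegral.integral_const_mul]
  congr 1
  funext ξ
  rw [mlRow, sub_sub_cancel]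
  ring

theorem mul_integral_eq_fourierInvT (a : ℂ) (τ x : ℝ) (h : ℝ → ℂ) :
    a * ((τ / Real.sqrt (2 * Real.pi) : ℝ) : ℂ) *
      ∫ k : ℝ, Complex.exp (-Complex.I * (k : ℂ) * (x : ℂ)) * h k =
      fourierInvT (fun k => a * (τ : ℂ) * h k) x := by
  rw [fourierInvT_const_mul, fourierInvT]
  push_cast
  ring

variable {n : ℕ} {μ γ θ : Fin n → ℝ} {f₁ g₁ f₂ g₂ : ℝ → ℂ} {φ N : ℝ → ℝ → ℂ}

/-- The convergence hypothesis in terms of `mlRow`, with the time variable `s = t - ξ` in the source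
term. -/
theorem formulaConverges_iff :
    FormulaConverges α β lam μ γ θ f₁ g₁ f₂ g₂ φ t ↔
      AbsConv (fun r k => (fourierT f₁ k + (lam : ℂ) * fourierT f₂ k) *
        mlRow α (α - β) lam (bSymbol μ γ θ k) α t r) ∧
      AbsConv (fun r k => (fourierT g₁ k + (lam : ℂ) * fourierT g₂ k) *
        mlRow α (α - β) lam (bSymbol μ γ θ k) (α - 1) t r) ∧
      AbsConv (fun r k => ∫ s in (0 : ℝ)..t,
        mlRow α (α - β) lam (bSymbol μ γ θ k) α (t - s) r * fourierT (fun y => φ y s) k) := by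
  constructor
  · rintro ⟨h1, h2, h3⟩
    simp only [mul_mlRow_eq] at h1
    simp only [mul_mlRow_sub_one_eq] at h2
    simp only [integral_mlRow_eq] at h3
    exact ⟨h1, h2, h3⟩
  · rintro ⟨h1, h2, h3⟩
    refine ⟨?_, ?_, ?_⟩
    · simpa only [mul_mlRow_eq] using h1
    · simpa only [mul_mlRow_sub_one_eq] using h2
    · simpa only [integral_mlRow_eq] using h3

/-- A series with initial data in Fourier space converges absolutely under rapid decay. -/
theorem absConv_mul_mlRow {σ : ℝ} (hα : 1 < α) (hβα : β ≤ α) (hlam : β = α → |lam| < 1)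
    (hμ : ∀ j, 0 < μ j) (hγ : ∀ j, 0 < γ j) (hσ : 0 < σ) (ht : 0 < t)
    (hf₁ : Integrable f₁) (hf₂ : Integrable f₂)
    (h₁ : ∀ c : ℝ, 0 < c → Integrable (fun k => weight α μ γ c k * ‖fourierT f₁ k‖))
    (h₂ : ∀ c : ℝ, 0 < c → Integrable (fun k => weight α μ γ c k * ‖fourierT f₂ k‖)) :
    AbsConv (fun r k => (fourierT f₁ k + (lam : ℂ) * fourierT f₂ k) *
        mlRow α (α - β) lam (bSymbol μ γ θ k) σ t r) := by
  have hα0 : 0 < α := by linarith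
  have hδ : 0 ≤ α - β := by linarith
  have hlam' : α - β = 0 → |lam| < 1 := fun h => hlam (by linarith)
  obtain ⟨C, c, hC, hc, h⟩ := exists_mlRow_bound (lam := lam) hα0 hδ hlam' hσ ht
  have hG := (((h₁ c hc).add ((h₂ c hc).const_mul |lam|)).const_mul (t ^ (σ - 1) * C))
  refine absConv_of_bound hG (fun r => ?_) fun k => ?_
  · refine AEStronglyMeasurable.mul ?_ (measurable_mlRow hα0 hδ hσ (measurable_bSymbol hγ)
      measurable_const r).aestronglyMeasurable
    exact ((continuous_fourierT hf₁).add
      (continuous_const.mul (continuous_fourierT hf₂))).aestronglyMeasurable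
  · have hB : 0 ≤ ∑ j, μ j * |k| ^ γ j :=
      (norm_nonneg _).trans (norm_bSymbol_le (θ := θ) hμ k)
    obtain ⟨e, he0, he, heC, hb⟩ := h _ hB
    set F := fourierT f₁ k + (lam : ℂ) * fourierT f₂ k with hF
    have hFn : ‖F‖ ≤ ‖fourierT f₁ k‖ + |lam| * ‖fourierT f₂ k‖ := by
      refine (norm_add_le _ _).trans (le_of_eq ?_)
      rw [norm_mul, Complex.norm_real, Real.norm_eq_abs]
    refine ⟨fun r => ‖F‖ * t ^ (σ - 1) * e r, he.mul_left _, fun r => ?_, ?_⟩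
    · simp only [norm_mul, mul_assoc]
      exact mul_le_mul_of_nonneg_left (hb _ (norm_bSymbol_le hμ k) t ht le_rfl r) (norm_nonneg _)
    · rw [tsum_mul_left]
      calc ‖F‖ * t ^ (σ - 1) * ∑' r, e r
          ≤ (‖fourierT f₁ k‖ + |lam| * ‖fourierT f₂ k‖) * t ^ (σ - 1) *
            (C * Real.exp (c * (∑ j, μ j * |k| ^ γ j) ^ (1 / α))) := by
            refine mul_le_mul (mul_le_mul_of_nonneg_right hFn (by positivity)) heC
              (tsum_nonneg he0) (by positivity)
        _ = _ := by
            simp only [Pi.add_apply, weight]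
            ring

/-- The series with the source term converges absolutely under rapid decay. -/
theorem absConv_integral_mlRow (hα : 1 < α) (hβα : β ≤ α) (hlam : β = α → |lam| < 1)
    (hμ : ∀ j, 0 < μ j) (hγ : ∀ j, 0 < γ j) (ht : 0 < t)
    (hφ : ∀ T : ℝ, 0 < T →
      IntegrableOn (fun p : ℝ × ℝ => φ p.1 p.2) (Set.univ ×ˢ Set.Ioc 0 T))
    (h : ∀ c T : ℝ, 0 < c → 0 < T →
      IntegrableOn (fun p : ℝ × ℝ => weight α μ γ c p.1 * ‖fourierT (fun y => φ y p.2) p.1‖)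
        (Set.univ ×ˢ Set.Ioc 0 T)) :
    AbsConv (fun r k => ∫ s in (0 : ℝ)..t,
        mlRow α (α - β) lam (bSymbol μ γ θ k) α (t - s) r * fourierT (fun y => φ y s) k) := by
  have hα0 : 0 < α := by linarith
  have hδ : 0 ≤ α - β := by linarith
  have hlam' : α - β = 0 → |lam| < 1 := fun h => hlam (by linarith)
  obtain ⟨C, c, hC, hc, hrow⟩ := exists_mlRow_bound (lam := lam) hα0 hδ hlam' hα0 ht
  have hw := h c t hc ht
  rw [IntegrableOn, Measure.volume_eq_prod, ← Measure.prod_restrict, Measure.restrict_univ] at hw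
  refine absConv_of_bound (hw.integral_prod_left.const_mul (t ^ (α - 1) * C))
    (fun r => ?_) fun k => ?_
  · simp only [intervalIntegral.integral_of_le ht.le]
    refine AEStronglyMeasurable.integral_prod_right' (f := fun p : ℝ × ℝ =>
      mlRow α (α - β) lam (bSymbol μ γ θ p.1) α (t - p.2) r * fourierT (fun y => φ y p.2) p.1) ?_
    refine AEStronglyMeasurable.mul ?_ (aestronglyMeasurable_fourierT (hφ t ht))
    exact (measurable_mlRow hα0 hδ hα0 ((measurable_bSymbol hγ).comp measurable_fst)
      (by fun_prop) r).aestronglyMeasurable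
  · have hB : 0 ≤ ∑ j, μ j * |k| ^ γ j :=
      (norm_nonneg _).trans (norm_bSymbol_le (θ := θ) hμ k)
    obtain ⟨e, he0, he, heC, hb⟩ := hrow _ hB
    have hφk := (integrableOn_fourierT (hφ t ht) k).norm
    set I := ∫ s in Set.Ioc 0 t, ‖fourierT (fun y => φ y s) k‖ with hI
    have hI0 : 0 ≤ I := integral_nonneg fun s => norm_nonneg _
    refine ⟨fun r => t ^ (α - 1) * I * e r, he.mul_left _, fun r => ?_, ?_⟩
    · have h1 : ‖∫ s in (0 : ℝ)..t, mlRow α (α - β) lam (bSymbol μ γ θ k) α (t - s) r *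
          fourierT (fun y => φ y s) k‖ ≤
          ∫ s in (0 : ℝ)..t, t ^ (α - 1) * e r * ‖fourierT (fun y => φ y s) k‖ := by
        refine intervalIntegral.norm_integral_le_of_norm_le ht.le ?_ ?_
        · have hne : ∀ᵐ s : ℝ, s ≠ t := compl_mem_ae_iff.2 (measure_singleton t)
          filter_upwards [hne] with s hs hst
          have h1 : 0 < t - s := sub_pos.2 (lt_of_le_of_ne hst.2 hs)
          rw [norm_mul]
          gcongr
          exact (hb _ (norm_bSymbol_le hμ k) (t - s) h1 (by linarith [hst.1]) r).trans
            (mul_le_mul_of_nonneg_right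
              (rpow_le_rpow_of_one_le hα.le h1.le (by linarith [hst.1])) (he0 r))
        · rw [intervalIntegrable_iff_integrableOn_Ioc_of_le ht.le]
          exact hφk.const_mul _
      refine h1.trans (le_of_eq ?_)
      rw [intervalIntegral.integral_const_mul, intervalIntegral.integral_of_le ht.le]
      ring
    · simp only [tsum_mul_left, integral_const_mul]
      calc t ^ (α - 1) * I * ∑' r, e r
          ≤ t ^ (α - 1) * I * (C * Real.exp (c * (∑ j, μ j * |k| ^ γ j) ^ (1 / α))) := by
            gcongr
        _ = _ := by
            simp only [weight]
            ring

end

end FracRD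

end

open FracRD in
theorem theorem2 (n : ℕ) (α β lam : ℝ) (μ γ θ : Fin n → ℝ)
    (hα : 1 < α) (hα2 : α ≤ 2) (hβ : 1 < β) (hβ2 : β ≤ 2)
    (hβα : β ≤ α) (hlam : β = α → |lam| < 1)
    (hμ : ∀ j, 0 < μ j) (hγ : ∀ j, 0 < γ j) (hγ2 : ∀ j, γ j ≤ 2)
    (hθ : ∀ j, |θ j| ≤ min (γ j) (2 - γ j))
    (f₁ g₁ f₂ g₂ : ℝ → ℂ) (φ N : ℝ → ℝ → ℂ)
    (hf₁ : MeasureTheory.Integrable f₁) (hg₁ : MeasureTheory.Integrable g₁)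
    (hf₂ : MeasureTheory.Integrable f₂) (hg₂ : MeasureTheory.Integrable g₂)
    (hφ : ∀ T : ℝ, 0 < T → MeasureTheory.IntegrableOn
      (fun p : ℝ × ℝ => φ p.1 p.2) (Set.univ ×ˢ Set.Ioc 0 T))
    (hN : IsSolution α β lam μ γ θ φ N)
    (hinit : HasInitialData α β lam f₁ g₁ f₂ g₂ N) :
    -- the solution formula, wherever its right-hand side converges absolutely
    (∀ t : ℝ, 0 < t → FormulaConverges α β lam μ γ θ f₁ g₁ f₂ g₂ φ t → ∀ x : ℝ,
      ∃ S₁ S₂ S₃ : ℂ,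
        HasSum (fun r : ℕ =>
          (-(lam : ℂ)) ^ r * ((t ^ ((α - β) * r + α - 1) / Real.sqrt (2 * Real.pi) : ℝ) : ℂ) *
            ∫ k : ℝ, Complex.exp (-Complex.I * (k : ℂ) * (x : ℂ)) *
              ((fourierT f₁ k + (lam : ℂ) * fourierT f₂ k) *
                mittagLeffler α (α + (α - β) * r) (r + 1)
                  (-(bSymbol μ γ θ k) * ((t ^ α : ℝ) : ℂ)))) S₁ ∧
        HasSum (fun r : ℕ =>
          (-(lam : ℂ)) ^ r * ((t ^ ((α - β) * r + α - 2) / Real.sqrt (2 * Real.pi) : ℝ) : ℂ) *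
            ∫ k : ℝ, Complex.exp (-Complex.I * (k : ℂ) * (x : ℂ)) *
              ((fourierT g₁ k + (lam : ℂ) * fourierT g₂ k) *
                mittagLeffler α (α + (α - β) * r - 1) (r + 1)
                  (-(bSymbol μ γ θ k) * ((t ^ α : ℝ) : ℂ)))) S₂ ∧
        HasSum (fun r : ℕ =>
          (-(lam : ℂ)) ^ r * ((1 / Real.sqrt (2 * Real.pi) : ℝ) : ℂ) *
            ∫ k : ℝ, Complex.exp (-Complex.I * (k : ℂ) * (x : ℂ)) *
              ∫ ξ in (0 : ℝ)..t, fourierT (fun y => φ y (t - ξ)) k *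
                ((ξ ^ ((α - β) * r + α - 1) : ℝ) : ℂ) *
                mittagLeffler α (α + (α - β) * r) (r + 1)
                  (-(bSymbol μ γ θ k) * ((ξ ^ α : ℝ) : ℂ))) S₃ ∧
        N x t = S₁ + S₂ + S₃) ∧
    -- it does so at all times when the Fourier transforms of the data decay rapidly
    (RapidDecay α μ γ f₁ g₁ f₂ g₂ φ →
      ∀ t : ℝ, 0 < t → FormulaConverges α β lam μ γ θ f₁ g₁ f₂ g₂ φ t) := by
  have hα0 : 0 < α := by linarith
  have hδ : 0 ≤ α - β := by linarith
  have hlam' : α - β = 0 → |lam| < 1 := fun h => hlam (by linarith)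
  refine ⟨fun t ht hconv x => ?_, fun h t ht => formulaConverges_iff.2
    ⟨absConv_mul_mlRow hα hβα hlam hμ hγ hα0 ht hf₁ hf₂ h.f₁ h.f₂,
      absConv_mul_mlRow hα hβα hlam hμ hγ (by linarith) ht hg₁ hg₂ h.g₁ h.g₂,
      absConv_integral_mlRow hα hβα hlam hμ hγ ht hφ h.φ⟩⟩
  obtain ⟨c1, c2, c3⟩ := formulaConverges_iff.1 hconv
  have v1 := fun k => (hasSum_mittagLeffler hα0 hδ hlam' hα0 ht (bSymbol μ γ θ k)).mul_left
    (fourierT f₁ k + (lam : ℂ) * fourierT f₂ k)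
  have v2 := fun k => (hasSum_mittagLeffler hα0 hδ hlam' (by linarith : 0 < α - 1) ht
    (bSymbol μ γ θ k)).mul_left (fourierT g₁ k + (lam : ℂ) * fourierT g₂ k)
  have v3 := fun k => hasSum_mlRow_conv hα0 hδ hlam' hα.le ht (bSymbol μ γ θ k)
    (integrableOn_fourierT (hφ t ht) k)
  have s1 := c1.hasSum_fourierInvT v1 x
  have s2 := c2.hasSum_fourierInvT v2 x
  have s3 := c3.hasSum_fourierInvT v3 x
  refine ⟨_, _, _, s1.congr_fun fun r => ?_, s2.congr_fun fun r => ?_, s3.congr_fun fun r => ?_, ?_⟩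
  · rw [mul_integral_eq_fourierInvT]
    simp only [mul_mlRow_eq]
  · rw [mul_integral_eq_fourierInvT]
    simp only [mul_mlRow_sub_one_eq]
  · rw [mul_integral_eq_fourierInvT]
    simp only [Complex.ofReal_one, mul_one,
      integral_mlRow_eq]
  · have i1 := c1.integrable v1
    have i2 := c2.integrable v2
    have i3 := c3.integrable v3
    have hmode : ∀ k, fourierT (fun y => N y t) k = _ := fun k =>
      (hN.isMode hinit hα hα2 hβ hβ2 hγ hf₁ hg₁ hf₂ hg₂ hφ k).eq_mlKernel hα hα2 hβα hlam
        (fun T hT => integrableOn_fourierT (hN.integrable_strip T hT) k)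
        (fun T hT => integrableOn_fourierT (hφ T hT) k) (hN.continuousOn_fourierT k) ht
    have hfun : fourierT (fun y => N y t) = _ := funext hmode
    have hc : Continuous fun y => N y t :=
      hN.continuousOn.comp_continuous (f := fun y : ℝ => (y, t)) (by fun_prop)
        fun y => ⟨Set.mem_univ _, ht⟩
    have hint : Integrable (fourierT fun y => N y t) := by
      rw [hfun]
      exact (i2.add i1).add i3
    have h21 := fourierInvT_add i2 i1 x
    have h213 := fourierInvT_add (i2.add i1) i3 x
    simp only [Pi.add_apply] at h213
    rw [← fourierInvT_fourierT (hN.integrable_space t ht) hc hint x, hfun, h213]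
    refine congrArg (· + _) (h21.trans (add_comm _ _))
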